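/- Let $\mathcal H$ be a complex Hilbert space. Setting. For self-adjoint operators $A_0,A$ in $\mathcal H$ and $z\in\mathbb C\setminus\mathbb R$ put $$M(z;A,A_0)=\bigl(I+(z-\bar z)(A-zI)^{-1}\bigr)\bigl(I+(\bar z-z)(A_0-\bar zI)^{-1}\bigr),$$ a unitary operator. Let $Y_\infty$ be the set of unitary operators $W$ in $\mathcal H$ with $W-I$ compact. Let $\widetilde X_\infty$ be the set of functions $g:\mathbb T\setminus\{1\}\to\mathbb Z$ such that $(0,2\pi)\ni\theta\mapsto g(e^{i\theta})$ is left continuous and non-increasing; with $\nu(n;g)=\sup(\{0\}\cup\{\theta\in(0,2\pi): g(e^{i\theta})>n\})$, it carries the metric $\widetilde\rho_\infty(g,h)=\sup_{n\in\mathbb Z}|\nu(n;g)-\nu(n;h)|$. Let $X_\infty=\widetilde X_\infty/\!\sim$, where $g\sim h$ iff $g-h$ is an integer constant, with the metric $\rho_\infty$ given by the infimum of $\widetilde\rho_\infty$ over representatives. For $W\in Y_\infty$ let $\eta_\infty(W)\in X_\infty$ be the class of $z\mapsto N(z,z_0;W)$, where, for $\theta_1,\theta_2\in(0,2\pi)$,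 $N(e^{i\theta_1},e^{i\theta_2};W)$ equals $\operatorname{rank}E_W([e^{i\theta_1},e^{i\theta_2}))$ if $\theta_1<\theta_2$, $0$ if $\theta_1=\theta_2$, and $-\operatorname{rank}E_W([e^{i\theta_2},e^{i\theta_1}))$ if $\theta_2<\theta_1$, $E_W$ being the spectral measure of $W$; the class does not depend on the point $z_0\in\mathbb T\setminus\{1\}$. Theorem. Let $H_0,H$ be self-adjoint (possibly unbounded) operators in $\mathcal H$, let $\Omega\subset\mathbb R$ be a Borel set with $\sigma(H_0)\cup\sigma(H)\subset\Omega$, and let $\lambda\in\Omega$. Let $f_1,f_2:\Omega\to\mathbb R$ be Borel functions such that for $j=1,2$: (a) $\lambda$ is an interior point of $\Omega$, $f_j$ is differentiable at $\lambda$ and $f_j'(\lambda)>0$; (b) $\inf\{|f_j(x)-f_j(\lambda)| : x\in\Omega,\ |x-\lambda|>\delta\}>0$ for every $\delta>0$; (c) $(f_j(H)-zI)^{-1}-(f_j(H_0)-zI)^{-1}$ is compact for every $z\in\mathbb C\setminus\mathbb R$. Then the limit $\lim_{y\to0+}\eta_\infty\bigl(M(f_j(\lambda)+iy;f_j(H),f_j(H_0))\bigr)$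 in $X_\infty$ exists for $j=1$ if and only if it exists for $j=2$; and when both limits exist, they coincide. -/

import Mathlib

open scoped InnerProductSpace ENNReal Topology
open Filter Set MeasureTheory

noncomputable section

namespace InvPrinciple

variable {H : Type*} [NormedAddCommGroup H] [InnerProductSpace ℂ H] [CompleteSpace H]

/-! ### Projection-valued measures and functions of a self-adjoint operator -/

/-- A projection-valued Borel measure on the real line: orthogonal projections, multiplicative,
normalised and countably additive in the strong operator topology. -/
structure PVM (H : Type*) [NormedAddCommGroup H] [InnerProductSpace ℂ H] [CompleteSpace H] where
  /-- The projection attached to a (Borel) set. -/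
  proj : Set ℝ → (H →L[ℂ] H)
  isProj : ∀ s, MeasurableSet s → IsStarProjection (proj s)
  univ : proj Set.univ = 1
  inter : ∀ s t, MeasurableSet s → MeasurableSet t → proj (s ∩ t) = proj s * proj t
  iUnion : ∀ s : ℕ → Set ℝ, (∀ n, MeasurableSet (s n)) →
    Pairwise (Function.onFun Disjoint s) →
    ∀ x, HasSum (fun n => proj (s n) x) (proj (⋃ n, s n) x)

namespace PVM

variable (E : PVM H)

theorem proj_empty : E.proj ∅ = 0 := by
  ext x
  have h := (E.iUnion (fun _ => ∅) (fun _ => MeasurableSet.empty)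
    (fun _ _ _ => disjoint_bot_left) x).summable
  have h' : Tendsto (fun _ : ℕ => E.proj ∅ x) atTop (𝓝 0) := h.tendsto_atTop_zero
  simpa using tendsto_nhds_unique tendsto_const_nhds h'

theorem norm_sq_proj {s : Set ℝ} (hs : MeasurableSet s) (x : H) :
    ‖E.proj s x‖ ^ 2 = (⟪x, E.proj s x⟫_ℂ).re := by
  have h := E.isProj s hs
  have h1 : ⟪E.proj s x, E.proj s x⟫_ℂ = ⟪x, E.proj s x⟫_ℂ := by
    have h2 : ContinuousLinearMap.adjoint (E.proj s) = E.proj s := h.isSelfAdjoint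
    have h3 : E.proj s (E.proj s x) = E.proj s x :=
      congrArg (fun T : H →L[ℂ] H => T x) h.isIdempotentElem
    nth_rewrite 1 [← h2]
    rw [ContinuousLinearMap.adjoint_inner_left, h3]
  rw [← h1, inner_self_eq_norm_sq_to_K]
  norm_cast

/-- The scalar spectral measure `s ↦ ‖E(s) x‖² = ⟨E(s) x, x⟩`. -/
def measure (x : H) : Measure ℝ :=
  Measure.ofMeasurable (fun s _ => ENNReal.ofReal (‖E.proj s x‖ ^ 2))
    (by simp [E.proj_empty])
    (by
      intro s hs hd
      have h1 : HasSum (fun n => ‖E.proj (s n) x‖ ^ 2) (‖E.proj (⋃ n, s n) x‖ ^ 2) := by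
        rw [E.norm_sq_proj (MeasurableSet.iUnion hs)]
        simp_rw [fun n => E.norm_sq_proj (hs n) x]
        exact ((E.iUnion s hs hd x).mapL (innerSL ℂ x)).mapL Complex.reCLM
      rw [← h1.tsum_eq, ENNReal.ofReal_tsum_of_nonneg (fun n => by positivity) h1.summable])

/-- `B = ∫ f dE`: the domain of `B` consists of all `x` with `∫ |f|² d⟨E x, x⟩ < ∞`, and
`⟨x, B x⟩ = ∫ f d⟨E x, x⟩` on this domain (which determines `B` by polarisation). -/
def IsIntegral (f : ℝ → ℝ) (B : H →ₗ.[ℂ] H) : Prop :=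
  (∀ x : H, x ∈ B.domain ↔ MemLp f 2 (E.measure x)) ∧
  ∀ x : B.domain, ⟪(x : H), B x⟫_ℂ = ((∫ t, f t ∂(E.measure (x : H)) : ℝ) : ℂ)

open Classical in
/-- The operator `∫ f dE`, for a real function `f` which is Borel up to an `E`-null set. -/
def integral (f : ℝ → ℝ) : H →ₗ.[ℂ] H :=
  if h : ∃ B, E.IsIntegral f B then Classical.choose h else ⊥

end PVM

open Classical in
/-- The Borel functional calculus: `f(A) = ∫ f dE`, where `E` is the spectral measure of the
self-adjoint operator `A`, that is, the projection-valued measure with `A = ∫ t dE(t)`. -/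
def funCalc (f : ℝ → ℝ) (A : H →ₗ.[ℂ] H) : H →ₗ.[ℂ] H :=
  if h : ∃ E : PVM H, E.IsIntegral (fun t => t) A then (Classical.choose h).integral f else ⊥

/-! ### Resolvents and the operator `M` -/

/-- `R` is the bounded two-sided inverse of `A - z`. -/
def IsResolventAt (A : H →ₗ.[ℂ] H) (z : ℂ) (R : H →L[ℂ] H) : Prop :=
  (∀ x : H, ∃ hx : R x ∈ A.domain, A ⟨R x, hx⟩ - z • R x = x) ∧
  ∀ x : A.domain, R (A x - z • (x : H)) = x

/-- The resolvent set `ρ(A)`. -/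
def resSet (A : H →ₗ.[ℂ] H) : Set ℂ := {z | ∃ R, IsResolventAt A z R}

/-- The spectrum `σ(A)`. -/
def spec (A : H →ₗ.[ℂ] H) : Set ℂ := (resSet A)ᶜ

open Classical in
/-- The resolvent `(A - z)⁻¹` (for `z ∈ ρ(A)`). -/
def resolv (A : H →ₗ.[ℂ] H) (z : ℂ) : H →L[ℂ] H :=
  if h : ∃ R, IsResolventAt A z R then Classical.choose h else 0

/-- The difference of the resolvents of `A` and `A₀` is compact at every non-real point. (For
self-adjoint `A`, `A₀` the non-real points lie in `ρ(A) ∩ ρ(A₀)`, and compactness at one point of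
`ρ(A) ∩ ρ(A₀)` is equivalent to compactness at all of them.) -/
def CompactResolventDiff (A A₀ : H →ₗ.[ℂ] H) : Prop :=
  ∀ z : ℂ, z.im ≠ 0 → IsCompactOperator (resolv A z - resolv A₀ z)

/-- `M(z; A, A₀) = (I + (z - z̄)(A - z)⁻¹)(I + (z̄ - z)(A₀ - z̄)⁻¹)`. -/
def opM (z : ℂ) (A A₀ : H →ₗ.[ℂ] H) : H →L[ℂ] H :=
  (1 + (z - star z) • resolv A z) * (1 + (star z - z) • resolv A₀ (star z))

/-! ### The metric space `X_∞`. The circle without `1` is parametrised by `θ ↦ exp(iθ)`,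
`0 < θ < 2π`. -/

/-- The parameter interval `(0, 2π)`. -/
abbrev Angle : Type := Set.Ioo (0 : ℝ) (2 * Real.pi)

/-- Non-increasing and left continuous. -/
def IsXTilde (f : Angle → ℤ) : Prop :=
  Antitone f ∧ ∀ θ : Angle, ContinuousWithinAt f (Set.Iic θ) θ

/-- The space `X̃_∞` of non-increasing left continuous integer-valued functions. -/
abbrev XTilde : Type := {f : Angle → ℤ // IsXTilde f}

/-- `ν(n; f) = sup ({0} ∪ {θ ∈ (0, 2π) | f(θ) > n})`. -/
def nu (n : ℤ) (f : XTilde) : ℝ :=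
  sSup ({0} ∪ {θ : ℝ | ∃ t : Angle, (t : ℝ) = θ ∧ n < f.1 t})

/-- The metric of `X̃_∞`: the `ℓ^∞(ℤ)` distance between `ν(·; f)` and `ν(·; g)`. -/
def rhoTilde (f g : XTilde) : ℝ := ⨆ n : ℤ, |nu n f - nu n g|

/-- Equality up to an additive integer constant. -/
instance xSetoid : Setoid XTilde where
  r f g := ∃ n : ℤ, ∀ θ, f.1 θ = g.1 θ + n
  iseqv :=
    { refl := fun _ => ⟨0, fun _ => by simp⟩
      symm := fun ⟨n, h⟩ => ⟨-n, fun θ => by rw [h θ]; ring⟩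
      trans := fun ⟨n, h⟩ ⟨m, k⟩ => ⟨m + n, fun θ => by rw [h θ, k θ]; ring⟩ }

/-- The space `X_∞ = X̃_∞ / ∼`. -/
abbrev XInf : Type := Quotient xSetoid

/-- The metric of `X_∞`. -/
def rho (f g : XInf) : ℝ :=
  sInf {r : ℝ | ∃ f' g' : XTilde, (⟦f'⟧ : XInf) = f ∧ (⟦g'⟧ : XInf) = g ∧ r = rhoTilde f' g'}

/-- `L = lim u(y)` as `y → 0+`, in the metric space `X_∞`. -/
def XLimit (u : ℝ → XInf) (L : XInf) : Prop :=
  Tendsto (fun y => rho (u y) L) (𝓝[>] (0 : ℝ)) (𝓝 0)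

/-! ### The map `η_∞` -/

/-- The set `Y_∞` of unitary operators `W` with `W - I` compact. -/
def YInf (H : Type*) [NormedAddCommGroup H] [InnerProductSpace ℂ H] [CompleteSpace H] :
    Set (H →L[ℂ] H) :=
  {W : H →L[ℂ] H | W ∈ unitary (H →L[ℂ] H) ∧ IsCompactOperator (W - 1 : H →L[ℂ] H)}

/-- The spectral subspace of `W ∈ Y_∞` for the arc `[exp(ia), exp(ib))`, `0 < a`, `b < 2π`. As
`W - I` is compact, the spectrum of `W` on the closed arc is a finite set of eigenvalues, so this
is the sum of the eigenspaces. -/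
def arcSpace (W : H →L[ℂ] H) (a b : ℝ) : Submodule ℂ H :=
  ⨆ θ : Set.Ico a b,
    Module.End.eigenspace (W : H →ₗ[ℂ] H) (Complex.exp (((θ : ℝ) : ℂ) * Complex.I))

/-- The rank of the spectral projection of `W` for the arc `[exp(ia), exp(ib))`. -/
def arcRank (W : H →L[ℂ] H) (a b : ℝ) : ℕ := Module.finrank ℂ (arcSpace W a b)

/-- The signed counting function `N(exp(iθ₁), exp(iθ₂); W)`. -/
def countN (W : H →L[ℂ] H) (θ₁ θ₂ : Angle) : ℤ :=
  if θ₁ < θ₂ then (arcRank W θ₁ θ₂ : ℤ)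
  else if θ₂ < θ₁ then -(arcRank W θ₂ θ₁ : ℤ) else 0

theorem eigenspace_orthogonal {W : H →L[ℂ] H} (hW : W ∈ unitary (H →L[ℂ] H)) {p q : ℂ}
    (hp : ‖p‖ = 1) (hpq : p ≠ q) {u v : H} (hu : W u = p • u) (hv : W v = q • v) :
    ⟪u, v⟫_ℂ = 0 := by
  have h1 : ⟪W u, W v⟫_ℂ = ⟪u, v⟫_ℂ := by
    have h2 : ContinuousLinearMap.adjoint W (W v) = v :=
      congrArg (fun T : H →L[ℂ] H => T v) (Unitary.star_mul_self_of_mem hW)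
    rw [← ContinuousLinearMap.adjoint_inner_right, h2]
  rw [hu, hv, inner_smul_left, inner_smul_right] at h1
  by_contra h0
  have h3 : (starRingEnd ℂ) p * q = 1 := by
    have h4 : ((starRingEnd ℂ) p * q) * ⟪u, v⟫_ℂ = 1 * ⟪u, v⟫_ℂ := by
      rw [one_mul]; linear_combination h1
    exact mul_right_cancel₀ h0 h4
  apply hpq
  have h5 : p * (starRingEnd ℂ) p = 1 := by
    rw [Complex.mul_conj, Complex.normSq_eq_norm_sq, hp]; simp
  calc p = p * ((starRingEnd ℂ) p * q) := by rw [h3, mul_one]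
    _ = (p * (starRingEnd ℂ) p) * q := by ring
    _ = q := by rw [h5, one_mul]

theorem exp_inj {s t : ℝ} (hs : s ∈ Set.Ioo 0 (2 * Real.pi)) (ht : t ∈ Set.Ioo 0 (2 * Real.pi))
    (h : Complex.exp (s * Complex.I) = Complex.exp (t * Complex.I)) : s = t := by
  rw [Complex.exp_eq_exp_iff_exists_int] at h
  obtain ⟨n, hn⟩ := h
  have h1 : s = t + n * (2 * Real.pi) := by
    have := congrArg Complex.im hn
    simpa using this
  have hpi := Real.pi_pos
  obtain ⟨a1, a2⟩ := hs
  obtain ⟨b1, b2⟩ := ht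
  have h2 : (n : ℝ) < 1 := by
    by_contra! hc
    nlinarith
  have h3 : (-1 : ℝ) < n := by
    by_contra! hc
    nlinarith
  have : n = 0 := by
    have h4 : n < 1 := by exact_mod_cast h2
    have h5 : -1 < n := by exact_mod_cast h3
    omega
  simpa [this] using h1

theorem arcSpace_bound {W : H →L[ℂ] H} (hW : W ∈ unitary (H →L[ℂ] H)) {a b : ℝ} (ha : 0 < a)
    (hb : b < 2 * Real.pi) :
    ∃ c : ℝ, 0 < c ∧ ∀ v ∈ arcSpace W a b, c * ‖v‖ ≤ ‖(W - 1) v‖ := by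
  classical
  obtain ⟨c, hc, hcb⟩ : ∃ c : ℝ, 0 < c ∧ ∀ θ ∈ Set.Icc a b,
      c ≤ ‖Complex.exp (((θ : ℝ) : ℂ) * Complex.I) - 1‖ := by
    have hcont : Continuous fun θ : ℝ => ‖Complex.exp ((θ : ℂ) * Complex.I) - 1‖ := by fun_prop
    rcases (Set.Icc a b).eq_empty_or_nonempty with he | hne
    · exact ⟨1, one_pos, by simp [he]⟩
    obtain ⟨t, ht, hmin⟩ := isCompact_Icc.exists_isMinOn hne hcont.continuousOn
    refine ⟨_, ?_, fun θ hθ => hmin hθ⟩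
    rw [norm_pos_iff, sub_ne_zero]
    intro h
    rw [Complex.exp_eq_one_iff] at h
    obtain ⟨n, hn⟩ := h
    have h1 : t = n * (2 * Real.pi) := by simpa using congrArg Complex.im hn
    have hpi := Real.pi_pos
    have h2 : (n : ℝ) < 1 := by
      by_contra! h; nlinarith [ht.2]
    have h3 : (0 : ℝ) < n := by
      by_contra! h; nlinarith [ht.1]
    have h4 : n < 1 := by exact_mod_cast h2
    have h5 : 0 < n := by exact_mod_cast h3
    omega
  refine ⟨c, hc, fun v hv => ?_⟩
  let z : Set.Ico a b → ℂ := fun θ => Complex.exp (((θ : ℝ) : ℂ) * Complex.I)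
  let V : Set.Ico a b → Submodule ℂ H := fun θ =>
    Module.End.eigenspace (W : H →ₗ[ℂ] H) (z θ)
  have hmem : ∀ θ, ∀ u : V θ, W (u : H) = z θ • (u : H) := fun θ u =>
    Module.End.mem_eigenspace_iff.mp u.2
  have hort : OrthogonalFamily ℂ (fun θ => V θ) (fun θ => (V θ).subtypeₗᵢ) := by
    intro s t hst u w
    refine eigenspace_orthogonal hW (p := z s) (q := z t) (Complex.norm_exp_ofReal_mul_I _) ?_
      (hmem s u) (hmem t w)
    intro h
    exact hst (Subtype.ext (exp_inj ⟨ha.trans_le s.2.1, s.2.2.trans hb⟩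
      ⟨ha.trans_le t.2.1, t.2.2.trans hb⟩ h))
  obtain ⟨l, hl⟩ := (Submodule.mem_iSup_iff_exists_dfinsupp' (p := V) v).mp hv
  have hv1 : v = ∑ i ∈ l.support, (V i).subtypeₗᵢ (l i) := by
    rw [← hl]; rfl
  have hv2 : (W - 1) v = ∑ i ∈ l.support, (V i).subtypeₗᵢ ((z i - 1) • l i) := by
    rw [hv1, map_sum]
    refine Finset.sum_congr rfl fun i _ => ?_
    have := hmem i (l i)
    simp [this, sub_smul]
  have hn1 : ‖v‖ ^ 2 = ∑ i ∈ l.support, ‖l i‖ ^ 2 := by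
    rw [hv1]; exact hort.norm_sum (fun i => l i) l.support
  have hn2 : ‖(W - 1) v‖ ^ 2 = ∑ i ∈ l.support, ‖(z i - 1) • l i‖ ^ 2 := by
    rw [hv2]; exact hort.norm_sum (fun i => (z i - 1) • l i) l.support
  refine le_of_sq_le_sq ?_ (norm_nonneg _)
  rw [mul_pow, hn1, hn2, Finset.mul_sum]
  refine Finset.sum_le_sum fun i _ => ?_
  rw [norm_smul, mul_pow]
  have := hcb i ⟨i.2.1, i.2.2.le⟩
  gcongr

theorem arcSpace_finite {W : H →L[ℂ] H} (hW : W ∈ YInf H) {a b : ℝ} (ha : 0 < a)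
    (hb : b < 2 * Real.pi) : FiniteDimensional ℂ (arcSpace W a b) := by
  obtain ⟨c, hc, hcb⟩ := arcSpace_bound hW.1 ha hb
  let K : arcSpace W a b →L[ℂ] H := (W - 1).comp (arcSpace W a b).subtypeL
  have hK : AntilipschitzWith (Real.toNNReal c⁻¹) K := by
    refine ContinuousLinearMap.antilipschitz_of_bound K fun x => ?_
    have h := hcb x x.2
    rw [Real.coe_toNNReal _ (by positivity), inv_mul_eq_div, le_div_iff₀ hc, mul_comm]
    exact h
  have hcomp : IsCompactOperator K := hW.2.comp_clm _
  obtain ⟨C, hC, hU⟩ := hcomp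
  refine FiniteDimensional.of_totallyBounded_nhds_zero ℂ hU ?_
  exact totallyBounded_preimage (hK.isUniformInducing K.uniformContinuous) hC.totallyBounded

theorem arcSpace_mono (W : H →L[ℂ] H) {a b a' b' : ℝ} (h1 : a' ≤ a) (h2 : b ≤ b') :
    arcSpace W a b ≤ arcSpace W a' b' :=
  iSup_le fun θ => le_iSup (fun θ : Set.Ico a' b' => Module.End.eigenspace (W : H →ₗ[ℂ] H)
    (Complex.exp (((θ : ℝ) : ℂ) * Complex.I))) ⟨θ, h1.trans θ.2.1, θ.2.2.trans_le h2⟩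

theorem arcRank_add {W : H →L[ℂ] H} (hW : W ∈ YInf H) {a b c : ℝ} (ha : 0 < a) (hab : a ≤ b)
    (hbc : b ≤ c) (hc : c < 2 * Real.pi) : arcRank W a c = arcRank W a b + arcRank W b c := by
  have hsup : arcSpace W a c = arcSpace W a b ⊔ arcSpace W b c := by
    apply le_antisymm
    · refine iSup_le fun θ => ?_
      rcases lt_or_ge (θ : ℝ) b with h | h
      · exact le_trans (le_iSup (fun θ : Set.Ico a b => Module.End.eigenspace (W : H →ₗ[ℂ] H)
          (Complex.exp (((θ : ℝ) : ℂ) * Complex.I))) ⟨θ, θ.2.1, h⟩) le_sup_left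
      · exact le_trans (le_iSup (fun θ : Set.Ico b c => Module.End.eigenspace (W : H →ₗ[ℂ] H)
          (Complex.exp (((θ : ℝ) : ℂ) * Complex.I))) ⟨θ, h, θ.2.2⟩) le_sup_right
    · exact sup_le (arcSpace_mono W le_rfl hbc) (arcSpace_mono W hab le_rfl)
  have hort : arcSpace W a b ⟂ arcSpace W b c := by
    simp only [arcSpace, Submodule.isOrtho_iSup_left, Submodule.isOrtho_iSup_right]
    intro t s
    rw [Submodule.isOrtho_iff_inner_eq]
    intro u hu v hv
    refine eigenspace_orthogonal hW.1 (Complex.norm_exp_ofReal_mul_I _) ?_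
      (Module.End.mem_eigenspace_iff.mp hu) (Module.End.mem_eigenspace_iff.mp hv)
    intro h
    have := exp_inj ⟨ha.trans_le s.2.1, (s.2.2.trans_le hbc).trans hc⟩
      ⟨(ha.trans_le hab).trans_le t.2.1, t.2.2.trans hc⟩ h
    have h1 := s.2.2
    have h2 := t.2.1
    linarith
  have := arcSpace_finite hW ha (hbc.trans_lt hc)
  have := arcSpace_finite hW (ha.trans_le hab) hc
  have key := Submodule.finrank_sup_add_finrank_inf_eq (arcSpace W a b) (arcSpace W b c)
  rw [hort.disjoint.eq_bot, finrank_bot, add_zero, ← hsup] at key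
  exact key

theorem countN_add {W : H →L[ℂ] H} (hW : W ∈ YInf H) (a b c : Angle) :
    countN W a c = countN W a b + countN W b c := by
  have add := fun (x y z : Angle) (h1 : x ≤ y) (h2 : y ≤ z) =>
    arcRank_add hW x.2.1 (show (x : ℝ) ≤ y from h1) (show (y : ℝ) ≤ z from h2) z.2.2
  rcases eq_or_ne a b with rfl | hab
  · simp [countN]
  rcases eq_or_ne b c with rfl | hbc
  · simp [countN]
  rcases eq_or_ne a c with rfl | hac
  · rcases hab.lt_or_gt with h | h <;> simp [countN, h, not_lt_of_gt h]
  simp only [countN]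
  rcases hab.lt_or_gt with h1 | h1 <;> rcases hbc.lt_or_gt with h2 | h2 <;>
    rcases hac.lt_or_gt with h3 | h3
  · simp only [h1, h2, h3, if_true, add a b c h1.le h2.le]; push_cast; ring
  · exfalso; order
  · simp only [h1, h2, h3, if_true, not_lt_of_gt h2, if_false, add a c b h3.le h2.le]
    push_cast; ring
  · simp only [h1, h2, h3, if_true, not_lt_of_gt h2, not_lt_of_gt h3, if_false,
      add c a b h3.le h1.le]
    push_cast; ring
  · simp only [h1, h2, h3, if_true, not_lt_of_gt h1, if_false, add b a c h1.le h3.le]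
    push_cast; ring
  · simp only [h1, h2, h3, if_true, not_lt_of_gt h1, not_lt_of_gt h3, if_false,
      add b c a h2.le h3.le]
    push_cast; ring
  · exfalso; order
  · simp only [h1, h2, h3, if_true, not_lt_of_gt h1, not_lt_of_gt h2, not_lt_of_gt h3, if_false,
      add c b a h2.le h1.le]
    push_cast; ring

theorem isXTilde_countN {W : H →L[ℂ] H} (hW : W ∈ YInf H) (θ₀ : Angle) :
    IsXTilde (fun θ => countN W θ θ₀) := by
  constructor
  · intro s t hst
    have h := countN_add hW s t θ₀
    have h0 : 0 ≤ countN W s t := by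
      rcases hst.lt_or_eq with h1 | rfl
      · simp [countN, h1]
      · simp [countN]
    simp only
    linarith
  · intro θ
    obtain ⟨t, ht⟩ : ∃ t : Angle, t < θ :=
      ⟨⟨θ / 2, by have := θ.2.1; simp; linarith, by have h1 := θ.2.1; have h2 := θ.2.2; linarith⟩,
        by have := θ.2.1; show (θ : ℝ) / 2 < θ; linarith⟩
    -- choose `s < θ` so that the rank of `[s, θ)` is minimal
    obtain ⟨s, hs, hmin⟩ : ∃ s : Angle, s < θ ∧ ∀ r : Angle, r < θ →
        arcRank W s θ ≤ arcRank W r θ := by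
      classical
      have hex : ∃ n : ℕ, ∃ s : Angle, s < θ ∧ arcRank W s θ = n := ⟨_, t, ht, rfl⟩
      obtain ⟨s, hs, hn⟩ := Nat.find_spec hex
      exact ⟨s, hs, fun r hr => hn ▸ Nat.find_min' hex ⟨r, hr, rfl⟩⟩
    have hbot : ∀ r : Angle, s ≤ r → r < θ → arcRank W r θ = 0 := by
      have h1 : arcSpace W s θ = ⊥ := by
        refine eq_bot_iff.mpr (iSup_le fun x => ?_)
        obtain ⟨r, hxr, hrθ⟩ := exists_between x.2.2
        let r' : Angle := ⟨r, (s.2.1.trans_le x.2.1).trans hxr, hrθ.trans θ.2.2⟩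
        have hsr : (s : ℝ) ≤ r := x.2.1.trans hxr.le
        have h2 := arcRank_add hW s.2.1 hsr hrθ.le θ.2.2
        have h3 := hmin r' hrθ
        have h4 : arcRank W s r = 0 := by
          change arcRank W s θ ≤ arcRank W r θ at h3
          omega
        have := arcSpace_finite hW s.2.1 (hrθ.trans θ.2.2)
        have h5 : arcSpace W s r = ⊥ := Submodule.finrank_eq_zero.mp h4
        rw [← h5]
        exact le_iSup (fun y : Set.Ico (s : ℝ) r => Module.End.eigenspace (W : H →ₗ[ℂ] H)
          (Complex.exp (((y : ℝ) : ℂ) * Complex.I))) ⟨x, x.2.1, hxr⟩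
      intro r hsr _
      have h2 : arcSpace W r θ = ⊥ :=
        eq_bot_iff.mpr (h1 ▸ arcSpace_mono W (show (s : ℝ) ≤ r from hsr) le_rfl)
      rw [arcRank, h2, finrank_bot]
    have hev : (fun _ : Angle => countN W θ θ₀) =ᶠ[𝓝[≤] θ] fun r => countN W r θ₀ := by
      have : Set.Ioi s ∈ 𝓝[≤] θ := mem_nhdsWithin_of_mem_nhds (Ioi_mem_nhds hs)
      filter_upwards [this, self_mem_nhdsWithin] with r hr1 hr2
      rcases (show r ≤ θ from hr2).lt_or_eq with h | rfl
      · rw [countN_add hW r θ θ₀]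
        simp [countN, h, hbot r (le_of_lt hr1) h]
      · rfl
    exact tendsto_const_nhds.congr' hev

/-- The reference angle `π`. -/
def angPi : Angle := ⟨Real.pi, Real.pi_pos, by linarith [Real.pi_pos]⟩

open Classical in
/-- The map `η_∞ : Y_∞ → X_∞`, `W ↦ π_∞(N(·, z₀; W))`; the class does not depend on the reference
point `z₀`, and `z₀ = -1` is taken. -/
def etaInf (W : H →L[ℂ] H) : XInf :=
  if hW : W ∈ YInf H then ⟦⟨fun θ => countN W θ angPi, isXTilde_countN hW angPi⟩⟧
  else ⟦⟨fun _ => 0, antitone_const, fun _ => continuousWithinAt_const⟩⟧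

theorem etaInf_eq {W : H →L[ℂ] H} (hW : W ∈ YInf H) (θ₀ : Angle) :
    etaInf W = ⟦⟨fun θ => countN W θ θ₀, isXTilde_countN hW θ₀⟩⟧ := by
  rw [etaInf, dif_pos hW]
  exact Quotient.sound ⟨countN W θ₀ angPi, fun θ => countN_add hW θ θ₀ angPi⟩

/-! ### The condition on the function -/

/-- The condition on `f : Ω → ℝ` at the point `l` (`f` is a function on the line of which only the
values on `Ω` are used). -/
structure FunCondition (Ω : Set ℝ) (f : ℝ → ℝ) (l : ℝ) : Prop where
  borel : Measurable (Ω.domRestrict f)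
  interior : l ∈ interior Ω
  differentiable : DifferentiableAt ℝ f l
  deriv_pos : 0 < deriv f l
  separated : ∀ δ > 0, ∃ c > 0, ∀ x ∈ Ω, δ < |x - l| → c ≤ |f x - f l|

/-- The curve `y ↦ η_∞(M(f(l) + iy; f(A), f(A₀)))` in `X_∞`. -/
def etaCurve (f : ℝ → ℝ) (l : ℝ) (A A₀ : H →ₗ.[ℂ] H) (y : ℝ) : XInf :=
  etaInf (opM ((f l : ℂ) + (y : ℂ) * Complex.I) (funCalc f A) (funCalc f A₀))

end InvPrinciple

end

open InvPrinciple

noncomputable section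

set_option linter.unusedSectionVars false

namespace InvPrinciple

variable {H : Type*} [NormedAddCommGroup H] [InnerProductSpace ℂ H] [CompleteSpace H]

namespace PVM

variable (E : PVM H)

/-! ### The bounded functional calculus of a projection-valued measure -/

/-! The operator `M` is a product of two Cayley transforms, one of `f(H)` at `z` and one of `f(H₀)`
at `z̄`. At `z = f(λ) + iy` the first is the function `1 + 2iy / (f(t) - f(λ) - iy)` of `H`, and the
second is the complex conjugate function of `H₀`. Multiplying `f - f(λ)` and `y` by the same
positive number does not change this symbol, so `f` at height `y` is to be compared with `g` at
height `cy`, where `c = g'(λ)/f'(λ)`.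

With this rescaling the symbols become uniformly close on `Ω` as `y → 0+`
(`eventually_norm_cayleyFun_sub_le`). Near `λ` the functions `(g - g(λ))/c` and `f - f(λ)` agree up
to a small relative error, which bounds the difference of the symbols independently of `y`; away
from `λ` the separation condition puts both symbols within `O(y)` of `1`. The spectral measures are
carried by `Ω`, so the two operators `M` become close in norm (`norm_opM_sub_le`).

The map `η_∞` is uniformly continuous from the norm to `ρ`: if `‖W - W'‖ < 1 - cos δ`, then `ρ ≤ δ`
(`rho_etaInf_le`). Indeed the spectral subspace of an arc is governed by the form `Re e^{-iφ}⟨x,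
Wx⟩` with `φ` the midpoint of the arc, and a dimension count in the manner of Glazman's lemma shows
that widening an arc by `δ` at both ends absorbs the perturbation (`arcRank_le_of_norm_sub_lt`).

Hence the distance between the two curves, one of them reparametrised by `y ↦ cy`, tends to zero,
and a limit of one is a limit of the other (`XLimit.transfer`). That limits coincide uses that `ρ`
separates points (`eq_of_rho_eq_zero`). The functional calculus below turns bounds on symbols into
bounds on operators, for the operators defined through `IsIntegral` and `IsResolventAt`. -/

theorem proj_proj {s : Set ℝ} (hs : MeasurableSet s) (x : H) :
    E.proj s (E.proj s x) = E.proj s x :=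
  congrArg (fun T : H →L[ℂ] H => T x) (E.isProj s hs).isIdempotentElem

theorem adjoint_proj {s : Set ℝ} (hs : MeasurableSet s) :
    ContinuousLinearMap.adjoint (E.proj s) = E.proj s :=
  (E.isProj s hs).isSelfAdjoint

theorem measure_apply (x : H) {s : Set ℝ} (hs : MeasurableSet s) :
    E.measure x s = ENNReal.ofReal (‖E.proj s x‖ ^ 2) :=
  Measure.ofMeasurable_apply s hs

instance isFiniteMeasure_measure (x : H) : IsFiniteMeasure (E.measure x) :=
  ⟨by rw [E.measure_apply x MeasurableSet.univ]; exact ENNReal.ofReal_lt_top⟩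

theorem measureReal_apply (x : H) {s : Set ℝ} (hs : MeasurableSet s) :
    (E.measure x).real s = ‖E.proj s x‖ ^ 2 := by
  rw [Measure.real, E.measure_apply x hs, ENNReal.toReal_ofReal (by positivity)]

theorem measureReal_univ (x : H) : (E.measure x).real Set.univ = ‖x‖ ^ 2 := by
  rw [E.measureReal_apply x MeasurableSet.univ, E.univ]; simp

theorem inner_proj {s : Set ℝ} (hs : MeasurableSet s) (x : H) :
    ⟪x, E.proj s x⟫_ℂ = ((E.measure x).real s : ℂ) := by
  have h1 : ⟪E.proj s x, E.proj s x⟫_ℂ = ⟪x, E.proj s x⟫_ℂ := by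
    nth_rewrite 1 [← E.adjoint_proj hs]
    rw [ContinuousLinearMap.adjoint_inner_left, E.proj_proj hs]
  rw [← h1, inner_self_eq_norm_sq_to_K, E.measureReal_apply x hs]
  norm_cast

theorem measure_proj {s : Set ℝ} (hs : MeasurableSet s) (x : H) :
    E.measure (E.proj s x) = (E.measure x).restrict s := by
  ext t ht
  rw [E.measure_apply _ ht, Measure.restrict_apply ht, E.measure_apply _ (ht.inter hs),
    E.inter t s ht hs]
  rfl

/-- A bounded Borel function. -/
structure BddMeas (g : ℝ → ℂ) : Prop where
  measurable : Measurable g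
  bound : ∃ C, ∀ t, ‖g t‖ ≤ C

namespace BddMeas

theorem integrable {g : ℝ → ℂ} (hg : BddMeas g) (μ : Measure ℝ) [IsFiniteMeasure μ] :
    Integrable g μ := by
  obtain ⟨C, hC⟩ := hg.bound
  exact Integrable.of_bound hg.measurable.aestronglyMeasurable C (ae_of_all _ hC)

theorem add {g h : ℝ → ℂ} (hg : BddMeas g) (hh : BddMeas h) : BddMeas (fun t => g t + h t) := by
  obtain ⟨C, hC⟩ := hg.bound
  obtain ⟨D, hD⟩ := hh.bound
  exact ⟨hg.measurable.add hh.measurable, C + D,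
    fun t => (norm_add_le _ _).trans (add_le_add (hC t) (hD t))⟩

theorem mul {g h : ℝ → ℂ} (hg : BddMeas g) (hh : BddMeas h) : BddMeas (fun t => g t * h t) := by
  obtain ⟨C, hC⟩ := hg.bound
  obtain ⟨D, hD⟩ := hh.bound
  refine ⟨hg.measurable.mul hh.measurable, C * D, fun t => ?_⟩
  rw [norm_mul]
  exact mul_le_mul (hC t) (hD t) (norm_nonneg _) ((norm_nonneg _).trans (hC t))

theorem const (c : ℂ) : BddMeas (fun _ => c) := ⟨measurable_const, ‖c‖, fun _ => le_rfl⟩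

theorem const_mul {g : ℝ → ℂ} (c : ℂ) (hg : BddMeas g) : BddMeas (fun t => c * g t) :=
  (const c).mul hg

theorem sub {g h : ℝ → ℂ} (hg : BddMeas g) (hh : BddMeas h) : BddMeas (fun t => g t - h t) := by
  simpa [sub_eq_add_neg] using hg.add (hh.const_mul (-1))

theorem star {g : ℝ → ℂ} (hg : BddMeas g) : BddMeas (fun t => (starRingEnd ℂ) (g t)) := by
  obtain ⟨C, hC⟩ := hg.bound
  exact ⟨Complex.continuous_conj.measurable.comp hg.measurable, C, fun t => by simpa using hC t⟩

theorem indicator {g : ℝ → ℂ} (hg : BddMeas g) {s : Set ℝ} (hs : MeasurableSet s) :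
    BddMeas (s.indicator g) := by
  obtain ⟨C, hC⟩ := hg.bound
  exact ⟨hg.measurable.indicator hs, C, fun t => (norm_indicator_le_norm_self _ _).trans (hC t)⟩

theorem simpleFunc (g : SimpleFunc ℝ ℂ) : BddMeas g :=
  ⟨g.measurable, g.exists_forall_norm_le⟩

end BddMeas

/-- `T = ∫ g dE`: the operator `T` commutes with `E`, and its quadratic form at `x` is the integral
of `g` against the scalar spectral measure of `x`. -/
structure Represents (g : ℝ → ℂ) (T : H →L[ℂ] H) : Prop where
  commute : ∀ s, MeasurableSet s → Commute T (E.proj s)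
  inner : ∀ x, ⟪x, T x⟫_ℂ = ∫ t, g t ∂(E.measure x)

variable {E}

/-- Polarisation over `ℂ`. It is the reason why `Represents` needs to prescribe only the quadratic
form. -/
theorem eq_of_inner_eq {S T : H →L[ℂ] H} (h : ∀ x, ⟪x, S x⟫_ℂ = ⟪x, T x⟫_ℂ) : S = T := by
  have := (ext_inner_map (S : H →ₗ[ℂ] H) (T : H →ₗ[ℂ] H)).mp fun x => by
    have := congrArg (starRingEnd ℂ) (h x)
    simpa [inner_conj_symm] using this
  ext x
  exact congrArg (fun F : H →ₗ[ℂ] H => F x) this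

namespace Represents

theorem unique {g : ℝ → ℂ} {S T : H →L[ℂ] H} (hS : E.Represents g S) (hT : E.Represents g T) :
    S = T :=
  eq_of_inner_eq fun x => by rw [hS.inner, hT.inner]

theorem congr' {g h : ℝ → ℂ} {T : H →L[ℂ] H} (hT : E.Represents g T) (hgh : ∀ t, g t = h t) :
    E.Represents h T := (funext hgh : g = h) ▸ hT

theorem add {g h : ℝ → ℂ} (hg : BddMeas g) (hh : BddMeas h) {S T : H →L[ℂ] H}
    (hS : E.Represents g S) (hT : E.Represents h T) :
    E.Represents (fun t => g t + h t) (S + T) := by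
  refine ⟨fun s hs => (hS.commute s hs).add_left (hT.commute s hs), fun x => ?_⟩
  rw [add_apply, inner_add_right, hS.inner, hT.inner,
    integral_add (hg.integrable _) (hh.integrable _)]

theorem const_mul {g : ℝ → ℂ} (c : ℂ) {T : H →L[ℂ] H} (hT : E.Represents g T) :
    E.Represents (fun t => c * g t) (c • T) := by
  refine ⟨fun s hs => (hT.commute s hs).smul_left c, fun x => ?_⟩
  rw [smul_apply, inner_smul_right, hT.inner, integral_const_mul]

theorem sub {g h : ℝ → ℂ} (hg : BddMeas g) (hh : BddMeas h) {S T : H →L[ℂ] H}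
    (hS : E.Represents g S) (hT : E.Represents h T) :
    E.Represents (fun t => g t - h t) (S - T) := by
  refine ⟨fun s hs => (hS.commute s hs).sub_left (hT.commute s hs), fun x => ?_⟩
  rw [sub_apply, inner_sub_right, hS.inner, hT.inner,
    integral_sub (hg.integrable _) (hh.integrable _)]

theorem one : E.Represents (fun _ => 1) 1 := by
  refine ⟨fun s _ => Commute.one_left _, fun x => ?_⟩
  have := E.inner_proj MeasurableSet.univ x
  rw [E.univ] at this
  rw [this]
  simp

theorem star {g : ℝ → ℂ} {T : H →L[ℂ] H} (hT : E.Represents g T) :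
    E.Represents (fun t => (starRingEnd ℂ) (g t)) (ContinuousLinearMap.adjoint T) := by
  refine ⟨fun s hs => ?_, fun x => ?_⟩
  · have h := (hT.commute s hs).star_star
    rwa [(E.isProj s hs).isSelfAdjoint.star_eq] at h
  · rw [ContinuousLinearMap.adjoint_inner_right, ← inner_conj_symm, hT.inner, integral_conj]

/-- Commutation turns `E(s)T` into `E(s)TE(s)`, whose form at `x` is the form of `T` at `E(s)x`, and
the scalar measure of `E(s)x` is the restriction to `s`. Commutation is part of `Represents` so that
this product can be read off diagonal values. -/
theorem indicator {g : ℝ → ℂ} {T : H →L[ℂ] H} (hT : E.Represents g T)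
    {s : Set ℝ} (hs : MeasurableSet s) : E.Represents (s.indicator g) (E.proj s * T) := by
  refine ⟨fun t ht => Commute.mul_left ?_ (hT.commute t ht), fun x => ?_⟩
  · rw [commute_iff_eq, ← E.inter s t hs ht, ← E.inter t s ht hs, Set.inter_comm]
  · have h1 : (E.proj s * T) x = E.proj s (T (E.proj s x)) := by
      rw [← E.proj_proj hs (T (E.proj s x))]
      have h2 : E.proj s (T (E.proj s x)) = E.proj s (E.proj s (T x)) :=
        congrArg (fun F : H →L[ℂ] H => E.proj s (F x)) (hT.commute s hs).eq
      rw [h2, E.proj_proj hs, E.proj_proj hs]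
      rfl
    rw [h1, ← ContinuousLinearMap.adjoint_inner_left, E.adjoint_proj hs, hT.inner,
      E.measure_proj hs, integral_indicator hs]

theorem proj {s : Set ℝ} (hs : MeasurableSet s) :
    E.Represents (s.indicator fun _ => 1) (E.proj s) := by
  simpa using (one (E := E)).indicator hs

end Represents

/-! ### From simple functions to bounded Borel functions -/

theorem tendsto_inner_of_tendsto {T : ℕ → H →L[ℂ] H} {S : H →L[ℂ] H}
    (h : ∀ x, Tendsto (fun n => T n x) atTop (𝓝 (S x))) (x y : H) :
    Tendsto (fun n => ⟪x, T n y⟫_ℂ) atTop (𝓝 ⟪x, S y⟫_ℂ) :=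
  tendsto_const_nhds.inner (h y)

/-- A sequence of functions converging pointwise and dominated by a constant. -/
structure BddTendsto (G : ℕ → ℝ → ℂ) (g : ℝ → ℂ) : Prop where
  measurable : ∀ n, Measurable (G n)
  bound : ∃ C, ∀ n t, ‖G n t‖ ≤ C
  tendsto : ∀ t, Tendsto (fun n => G n t) atTop (𝓝 (g t))

namespace BddTendsto

theorem bddMeas {G : ℕ → ℝ → ℂ} {g : ℝ → ℂ} (h : BddTendsto G g) (n : ℕ) : BddMeas (G n) :=
  ⟨h.measurable n, h.bound.imp fun _ hC => hC n⟩

theorem tendsto_integral {G : ℕ → ℝ → ℂ} {g : ℝ → ℂ} (h : BddTendsto G g) (μ : Measure ℝ)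
    [IsFiniteMeasure μ] : Tendsto (fun n => ∫ t, G n t ∂μ) atTop (𝓝 (∫ t, g t ∂μ)) := by
  obtain ⟨C, hC⟩ := h.bound
  exact tendsto_integral_of_dominated_convergence (fun _ => C)
    (fun n => (h.measurable n).aestronglyMeasurable) (integrable_const C)
    (fun n => ae_of_all _ (hC n)) (ae_of_all _ h.tendsto)

theorem mul_right {G : ℕ → ℝ → ℂ} {g k : ℝ → ℂ} (h : BddTendsto G g) (hk : BddMeas k) :
    BddTendsto (fun n t => G n t * k t) (fun t => g t * k t) := by
  obtain ⟨C, hC⟩ := h.bound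
  obtain ⟨D, hD⟩ := hk.bound
  refine ⟨fun n => (h.measurable n).mul hk.measurable, ⟨C * D, fun n t => ?_⟩,
    fun t => (h.tendsto t).mul_const _⟩
  rw [norm_mul]
  exact mul_le_mul (hC n t) (hD t) (norm_nonneg _) ((norm_nonneg _).trans (hC n t))

theorem exists_simpleFunc {g : ℝ → ℂ} (hg : BddMeas g) :
    ∃ G : ℕ → SimpleFunc ℝ ℂ, BddTendsto (fun n => G n) g := by
  obtain ⟨C, hC⟩ := hg.bound
  have hC0 : 0 ≤ C := (norm_nonneg _).trans (hC 0)
  have hm : StronglyMeasurable g := hg.measurable.stronglyMeasurable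
  exact ⟨hm.approxBounded C, fun n => (hm.approxBounded C n).measurable,
    ⟨C, fun n t => hm.norm_approxBounded_le hC0 n t⟩,
    fun t => hm.tendsto_approxBounded_of_norm_le (hC t)⟩

end BddTendsto

/-- Existence and multiplicativity go through one induction. The second factor `h` is arbitrary
bounded, not simple, so that the simple factor alone has to be passed to the limit later. -/
theorem exists_represents_simpleFunc (E : PVM H) (g : SimpleFunc ℝ ℂ) :
    ∃ T, E.Represents g T ∧ ∀ (h : ℝ → ℂ) (S : H →L[ℂ] H), BddMeas h → E.Represents h S →
      E.Represents (fun t => g t * h t) (T * S) := by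
  induction g using SimpleFunc.induction with
  | const c hs =>
    rename_i s
    refine ⟨c • E.proj s, ((Represents.proj hs).const_mul c).congr' fun t => ?_,
      fun h S _ hS => ?_⟩
    · by_cases ht : t ∈ s <;> simp [ht]
    · rw [smul_mul_assoc]
      refine ((hS.indicator hs).const_mul c).congr' fun t => ?_
      by_cases ht : t ∈ s <;> simp [ht]
  | add _ hf hg =>
    rename_i f g _
    obtain ⟨T₁, h₁, m₁⟩ := hf
    obtain ⟨T₂, h₂, m₂⟩ := hg
    refine ⟨T₁ + T₂, h₁.add (.simpleFunc f) (.simpleFunc g) h₂, fun h S hh hS => ?_⟩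
    rw [add_mul]
    exact ((m₁ h S hh hS).add ((BddMeas.simpleFunc f).mul hh) ((BddMeas.simpleFunc g).mul hh)
      (m₂ h S hh hS)).congr' fun t => by simp [add_mul]

/-- This is `‖Tx‖² = ⟨x, T*Tx⟩`. The symbol of `T*T` is a hypothesis because the identity is needed
for simple functions before multiplicativity is known in general. -/
theorem Represents.norm_sq_of_mul {g : ℝ → ℂ} {T : H →L[ℂ] H}
    (h : E.Represents (fun t => (starRingEnd ℂ) (g t) * g t)
      (ContinuousLinearMap.adjoint T * T)) (x : H) :
    ‖T x‖ ^ 2 = ∫ t, ‖g t‖ ^ 2 ∂(E.measure x) := by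
  have h1 := h.inner x
  have h2 : ⟪x, (ContinuousLinearMap.adjoint T * T) x⟫_ℂ = ((‖T x‖ ^ 2 : ℝ) : ℂ) := by
    rw [mul_apply_eq_comp, ContinuousLinearMap.adjoint_inner_right,
      inner_self_eq_norm_sq_to_K]
    norm_cast
  have h3 : ∀ t, (starRingEnd ℂ) (g t) * g t = ((‖g t‖ ^ 2 : ℝ) : ℂ) := fun t => by
    rw [mul_comm, Complex.mul_conj, Complex.normSq_eq_norm_sq]
  simp only [h3] at h1
  rw [h2, integral_complex_ofReal] at h1
  exact_mod_cast h1

/-- The vectors `u n` are an isometric copy of the functions `G n` in `L²(μ)`, which converge there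
by dominated convergence. The dominating function may be unbounded, as is needed for truncations of
an unbounded symbol. -/
theorem cauchySeq_of_norm_sq (μ : Measure ℝ) {G : ℕ → ℝ → ℂ} {g : ℝ → ℂ} {B : ℝ → ℝ}
    (hm : ∀ n, Measurable (G n)) (hb : ∀ n t, ‖G n t‖ ≤ B t)
    (hB : Integrable (fun t => B t ^ 2) μ)
    (hlim : ∀ t, Tendsto (fun n => G n t) atTop (𝓝 (g t))) {u : ℕ → H}
    (hu : ∀ n m, ‖u n - u m‖ ^ 2 = ∫ t, ‖G n t - G m t‖ ^ 2 ∂μ) : CauchySeq u := by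
  have hgm : Measurable g := measurable_of_tendsto_metrizable hm (tendsto_pi_nhds.mpr hlim)
  have hgb : ∀ t, ‖g t‖ ≤ B t := fun t =>
    le_of_tendsto ((hlim t).norm) (Eventually.of_forall fun n => hb n t)
  have hdom : ∀ n t, ‖G n t - g t‖ ^ 2 ≤ 4 * B t ^ 2 := fun n t => by
    have h1 : ‖G n t - g t‖ ≤ 2 * B t := (norm_sub_le _ _).trans (by linarith [hb n t, hgb t])
    calc ‖G n t - g t‖ ^ 2 ≤ (2 * B t) ^ 2 := by gcongr
      _ = 4 * B t ^ 2 := by ring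
  have hint : ∀ n, Integrable (fun t => ‖G n t - g t‖ ^ 2) μ := fun n =>
    (hB.const_mul 4).mono' (((hm n).sub hgm).norm.pow_const 2).aestronglyMeasurable
      (ae_of_all _ fun t => by simpa using hdom n t)
  have hb0 : Tendsto (fun n => ∫ t, ‖G n t - g t‖ ^ 2 ∂μ) atTop (𝓝 0) := by
    have : Tendsto (fun n => ∫ t, ‖G n t - g t‖ ^ 2 ∂μ) atTop (𝓝 (∫ _, (0 : ℝ) ∂μ)) := by
      refine tendsto_integral_of_dominated_convergence (fun t => 4 * B t ^ 2)
        (fun n => (hint n).aestronglyMeasurable) (hB.const_mul 4)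
        (fun n => ae_of_all _ fun t => by simpa using hdom n t) (ae_of_all _ fun t => ?_)
      have := ((hlim t).sub_const (g t)).norm.pow 2
      simpa using this
    simpa using this
  rw [Metric.cauchySeq_iff]
  intro ε hε
  obtain ⟨N, hN⟩ := (hb0.eventually_lt_const (show 0 < ε ^ 2 / 4 by positivity)).exists_forall_of_atTop
  refine ⟨N, fun n hn m hm' => ?_⟩
  have key : ‖u n - u m‖ ^ 2 < ε ^ 2 := by
    calc ‖u n - u m‖ ^ 2 = ∫ t, ‖G n t - G m t‖ ^ 2 ∂μ := hu n m
      _ ≤ ∫ t, (2 * ‖G n t - g t‖ ^ 2 + 2 * ‖G m t - g t‖ ^ 2) ∂μ := by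
        refine integral_mono_of_nonneg (ae_of_all _ fun t => by positivity)
          (((hint n).const_mul 2).add ((hint m).const_mul 2)) (ae_of_all _ fun t => ?_)
        have h1 : ‖G n t - G m t‖ ≤ ‖G n t - g t‖ + ‖G m t - g t‖ := by
          rw [← norm_sub_rev (g t) (G m t)]; exact norm_sub_le_norm_sub_add_norm_sub _ _ _
        have h2 : ‖G n t - G m t‖ ^ 2 ≤ (‖G n t - g t‖ + ‖G m t - g t‖) ^ 2 := by gcongr
        simp only
        nlinarith [sq_nonneg (‖G n t - g t‖ - ‖G m t - g t‖)]
      _ = 2 * (∫ t, ‖G n t - g t‖ ^ 2 ∂μ) + 2 * ∫ t, ‖G m t - g t‖ ^ 2 ∂μ := by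
        rw [integral_add ((hint n).const_mul 2) ((hint m).const_mul 2), integral_const_mul,
          integral_const_mul]
      _ < ε ^ 2 := by linarith [hN n hn, hN m hm']
  rw [dist_eq_norm]
  exact lt_of_pow_lt_pow_left₀ 2 hε.le key

/-- The operator is the strong limit of the operators of simple approximations of `g`; form,
commutation and multiplicativity all pass to the limit. -/
theorem exists_represents_mul (E : PVM H) {g : ℝ → ℂ} (hg : BddMeas g) :
    ∃ T, E.Represents g T ∧ ∀ (h : ℝ → ℂ) (S : H →L[ℂ] H), BddMeas h → E.Represents h S →
      E.Represents (fun t => g t * h t) (T * S) := by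
  obtain ⟨G, hG⟩ := BddTendsto.exists_simpleFunc hg
  choose T hT hmul using fun n => E.exists_represents_simpleFunc (G n)
  have hcauchy : ∀ x, CauchySeq fun n => T n x := by
    intro x
    obtain ⟨C, hC⟩ := hG.bound
    refine cauchySeq_of_norm_sq (E.measure x) hG.measurable hC (integrable_const _) hG.tendsto
      fun n m => ?_
    have hsub : E.Represents (G n - G m) (T n - T m) := (hT n).sub (.simpleFunc _) (.simpleFunc _) (hT m)
    have key : E.Represents (fun t => (starRingEnd ℂ) ((G n - G m) t) * (G n - G m) t)
        (ContinuousLinearMap.adjoint (T n - T m) * (T n - T m)) := by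
      -- The conjugate of a simple function is simple, so multiplicativity for simple functions
      -- already covers `T*T`.
      obtain ⟨S, hS, hSm⟩ := E.exists_represents_simpleFunc ((G n - G m).map (starRingEnd ℂ))
      have : S = ContinuousLinearMap.adjoint (T n - T m) := hS.unique hsub.star
      rw [← this]
      exact hSm _ _ (.simpleFunc _) hsub
    exact key.norm_sq_of_mul x
  choose S₀ hS₀ using fun x => cauchySeq_tendsto_of_complete (hcauchy x)
  -- Boundedness of the pointwise limit is the Banach–Steinhaus theorem.
  let S : H →L[ℂ] H := continuousLinearMapOfTendsto T (tendsto_pi_nhds.mpr hS₀)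
  have hS : ∀ x, Tendsto (fun n => T n x) atTop (𝓝 (S x)) := hS₀
  have hrep : E.Represents g S := by
    refine ⟨fun s hs => ?_, fun x => ?_⟩
    · ext x
      refine tendsto_nhds_unique (hS (E.proj s x)) ?_
      have := ((E.proj s).continuous.tendsto _).comp (hS x)
      refine this.congr fun n => ?_
      exact (congrArg (fun F : H →L[ℂ] H => F x) ((hT n).commute s hs).eq).symm
    · refine tendsto_nhds_unique (tendsto_inner_of_tendsto hS x x) ?_
      simp_rw [(hT _).inner]
      exact hG.tendsto_integral _
  refine ⟨S, hrep, fun h R hh hR => ⟨fun s hs => (hrep.commute s hs).mul_left (hR.commute s hs),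
    fun x => ?_⟩⟩
  refine tendsto_nhds_unique (tendsto_inner_of_tendsto hS x (R x)) ?_
  have h1 : ∀ n, ⟪x, T n (R x)⟫_ℂ = ∫ t, G n t * h t ∂(E.measure x) := fun n =>
    (hmul n h R hh hR).inner x
  simp_rw [h1]
  exact (hG.mul_right hh).tendsto_integral _

theorem exists_represents (E : PVM H) {g : ℝ → ℂ} (hg : BddMeas g) : ∃ T, E.Represents g T :=
  (E.exists_represents_mul hg).imp fun _ h => h.1

namespace Represents

theorem mul {g h : ℝ → ℂ} (hg : BddMeas g) (hh : BddMeas h) {S T : H →L[ℂ] H}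
    (hS : E.Represents g S) (hT : E.Represents h T) :
    E.Represents (fun t => g t * h t) (S * T) := by
  obtain ⟨S', hS', hm⟩ := E.exists_represents_mul hg
  rw [hS.unique hS']
  exact hm h T hh hT

theorem norm_sq {g : ℝ → ℂ} (hg : BddMeas g) {T : H →L[ℂ] H} (hT : E.Represents g T) (x : H) :
    ‖T x‖ ^ 2 = ∫ t, ‖g t‖ ^ 2 ∂(E.measure x) :=
  (hT.star.mul hg.star hg hT).norm_sq_of_mul x

/-- An almost everywhere bound suffices, so that symbols later have to be estimated on `Ω` only. -/
theorem norm_le {g : ℝ → ℂ} (hg : BddMeas g) {T : H →L[ℂ] H} (hT : E.Represents g T) {C : ℝ}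
    (hC0 : 0 ≤ C) (hC : ∀ x, ∀ᵐ t ∂(E.measure x), ‖g t‖ ≤ C) : ‖T‖ ≤ C := by
  refine T.opNorm_le_bound hC0 fun x => ?_
  refine le_of_sq_le_sq ?_ (by positivity)
  rw [hT.norm_sq hg x, mul_pow, ← E.measureReal_univ x]
  calc ∫ t, ‖g t‖ ^ 2 ∂(E.measure x) ≤ ∫ _, C ^ 2 ∂(E.measure x) := by
        refine integral_mono_of_nonneg (ae_of_all _ fun t => by positivity) (integrable_const _) ?_
        filter_upwards [hC x] with t ht
        gcongr
    _ = C ^ 2 * (E.measure x).real Set.univ := by rw [integral_const, smul_eq_mul, mul_comm]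

theorem measure_apply {g : ℝ → ℂ} (hg : BddMeas g) {T : H →L[ℂ] H} (hT : E.Represents g T)
    (x : H) :
    E.measure (T x) = (E.measure x).withDensity (fun t => ENNReal.ofReal (‖g t‖ ^ 2)) := by
  ext s hs
  rw [E.measure_apply _ hs, withDensity_apply _ hs]
  have h := (hT.indicator hs).norm_sq (hg.indicator hs) x
  rw [mul_apply_eq_comp] at h
  rw [h]
  have h2 : (fun t => ‖s.indicator g t‖ ^ 2) = s.indicator (fun t => ‖g t‖ ^ 2) := by
    ext t
    by_cases ht : t ∈ s <;> simp [ht]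
  rw [h2, integral_indicator hs, ofReal_integral_eq_lintegral_ofReal]
  · refine Integrable.congr ((hg.star.mul hg).integrable _).norm.restrict (ae_of_all _ fun t => ?_)
    simp [sq]
  · exact ae_of_all _ fun t => by positivity

theorem tendsto {G : ℕ → ℝ → ℂ} {g : ℝ → ℂ} (h : BddTendsto G g) {T : ℕ → H →L[ℂ] H}
    {S : H →L[ℂ] H} (hT : ∀ n, E.Represents (G n) (T n)) (hS : E.Represents g S) (x : H) :
    Tendsto (fun n => T n x) atTop (𝓝 (S x)) := by
  obtain ⟨C, hC⟩ := h.bound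
  have hg : BddMeas g :=
    ⟨measurable_of_tendsto_metrizable h.measurable (tendsto_pi_nhds.mpr h.tendsto), C,
      fun t => le_of_tendsto (h.tendsto t).norm (Eventually.of_forall fun n => hC n t)⟩
  have hsq : ∀ n, ‖T n x - S x‖ ^ 2 = ∫ t, ‖G n t - g t‖ ^ 2 ∂(E.measure x) := fun n =>
    ((hT n).sub (h.bddMeas n) hg hS).norm_sq ((h.bddMeas n).sub hg) x
  have hlim : Tendsto (fun n => ∫ t, ‖G n t - g t‖ ^ 2 ∂(E.measure x)) atTop (𝓝 0) := by
    have : Tendsto (fun n => ∫ t, ‖G n t - g t‖ ^ 2 ∂(E.measure x)) atTop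
        (𝓝 (∫ _, (0 : ℝ) ∂(E.measure x))) := by
      refine tendsto_integral_of_dominated_convergence (fun _ => (C + C) ^ 2)
        (fun n => (((h.measurable n).sub hg.measurable).norm.pow_const 2).aestronglyMeasurable)
        (integrable_const _) (fun n => ae_of_all _ fun t => ?_) (ae_of_all _ fun t => ?_)
      · have h1 : ‖G n t - g t‖ ≤ C + C := (norm_sub_le _ _).trans (add_le_add (hC n t)
          (le_of_tendsto (h.tendsto t).norm (Eventually.of_forall fun n => hC n t)))
        rw [Real.norm_of_nonneg (by positivity)]
        gcongr
      · have := ((h.tendsto t).sub_const (g t)).norm.pow 2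
        simpa using this
    simpa using this
  rw [tendsto_iff_norm_sub_tendsto_zero]
  have h0 : Tendsto (fun n => ‖T n x - S x‖ ^ 2) atTop (𝓝 0) := by simpa only [hsq] using hlim
  simpa using h0.sqrt

end Represents

end PVM

/-! ### Resolvents -/

theorem IsResolventAt.unique {A : H →ₗ.[ℂ] H} {z : ℂ} {R R' : H →L[ℂ] H}
    (hR : IsResolventAt A z R) (hR' : IsResolventAt A z R') : R = R' := by
  ext x
  obtain ⟨hx, h⟩ := hR.1 x
  have h2 := hR'.2 ⟨R x, hx⟩
  rw [h] at h2
  exact h2.symm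

theorem IsResolventAt.resolv_eq {A : H →ₗ.[ℂ] H} {z : ℂ} {R : H →L[ℂ] H}
    (hR : IsResolventAt A z R) : resolv A z = R := by
  have h : ∃ R, IsResolventAt A z R := ⟨R, hR⟩
  rw [resolv, dif_pos h]
  exact (Classical.choose_spec h).unique hR

/-- Either there is no resolvent and the default value `0` applies, or the resolvent takes its
values in the zero domain. -/
theorem resolv_bot (z : ℂ) : resolv (⊥ : H →ₗ.[ℂ] H) z = 0 := by
  by_cases h : ∃ R, IsResolventAt (⊥ : H →ₗ.[ℂ] H) z R
  · rw [resolv, dif_pos h]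
    ext x
    obtain ⟨hx, -⟩ := (Classical.choose_spec h).1 x
    exact (Submodule.mem_bot ℂ).mp hx
  · rw [resolv, dif_neg h]

namespace PVM

variable {E : PVM H}

/-! ### Integrals of unbounded real functions -/

/-- The function `(f - z)⁻¹`. -/
def resFun (f : ℝ → ℝ) (z : ℂ) (t : ℝ) : ℂ := ((f t : ℂ) - z)⁻¹

theorem ofReal_sub_ne_zero {z : ℂ} (hz : z.im ≠ 0) (s : ℝ) : (s : ℂ) - z ≠ 0 := by
  intro h
  apply hz
  have := congrArg Complex.im h
  simpa using this

theorem bddMeas_resFun {f : ℝ → ℝ} (hf : Measurable f) {z : ℂ} (hz : z.im ≠ 0) :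
    BddMeas (resFun f z) := by
  refine ⟨((Complex.measurable_ofReal.comp hf).sub_const z).inv, |z.im|⁻¹, fun t => ?_⟩
  rw [resFun, norm_inv]
  refine inv_anti₀ (abs_pos.mpr hz) ?_
  simpa using Complex.abs_im_le_norm ((f t : ℂ) - z)

/-- The integral of `|g|²` vanishes only if the scalar measure of `x` is zero, and its total mass is
`‖x‖²`. -/
theorem Represents.eq_zero_of_apply_eq_zero {g : ℝ → ℂ} (hg : BddMeas g) (h0 : ∀ t, g t ≠ 0)
    {T : H →L[ℂ] H} (hT : E.Represents g T) {x : H} (hx : T x = 0) : x = 0 := by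
  have h1 := hT.norm_sq hg x
  rw [hx, norm_zero, zero_pow two_ne_zero, eq_comm, integral_eq_zero_iff_of_nonneg] at h1
  · have h2 : ∀ᵐ t ∂(E.measure x), False := by
      filter_upwards [h1] with t ht
      exact h0 t (by simpa using ht)
    rw [eventually_false_iff_eq_bot, ae_eq_bot] at h2
    have h3 := E.measureReal_univ x
    rw [h2] at h3
    simpa using h3.symm
  · exact fun t => by positivity
  · refine Integrable.congr ((hg.star.mul hg).integrable _).norm (ae_of_all _ fun t => ?_)
    simp [sq]

theorem bddMeas_cutoff {g : ℝ → ℂ} (hg : Measurable g) (n : ℕ) :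
    BddMeas ({t | ‖g t‖ ≤ n}.indicator g) := by
  have hs : MeasurableSet {t | ‖g t‖ ≤ n} := measurableSet_le hg.norm measurable_const
  refine ⟨hg.indicator hs, n, fun t => ?_⟩
  by_cases ht : ‖g t‖ ≤ n <;> simp [ht]

/-- Every vector for which `f` is square integrable lies in the range of `(f - z)⁻¹`. -/
theorem exists_resFun_apply_eq {f : ℝ → ℝ} (hf : Measurable f) {z : ℂ} (hz : z.im ≠ 0)
    {R : H →L[ℂ] H} (hR : E.Represents (resFun f z) R) {x : H} (hx : MemLp f 2 (E.measure x)) :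
    ∃ y, R y = x := by
  let g : ℝ → ℂ := fun t => (f t : ℂ) - z
  have hg : Measurable g := (Complex.measurable_ofReal.comp hf).sub_const z
  let s : ℕ → Set ℝ := fun n => {t | ‖g t‖ ≤ n}
  have hs : ∀ n, MeasurableSet (s n) := fun n => measurableSet_le hg.norm measurable_const
  have hbd : ∀ n, BddMeas ((s n).indicator g) := bddMeas_cutoff hg
  have hev : ∀ t, ∀ᶠ n in atTop, t ∈ s n := fun t => by
    obtain ⟨N, hN⟩ := exists_nat_ge ‖g t‖
    filter_upwards [eventually_ge_atTop N] with n hn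
    exact hN.trans (by exact_mod_cast hn)
  choose T hT using fun n => E.exists_represents (hbd n)
  have hgL : MemLp g 2 (E.measure x) := (hx.ofReal (K := ℂ)).sub (memLp_const z)
  have hgi : Integrable (fun t => ‖g t‖ ^ 2) (E.measure x) :=
    (memLp_two_iff_integrable_sq_norm hg.aestronglyMeasurable).mp hgL
  -- The preimage of `x` is the limit of the truncated integrals of `f - z` applied to `x`;
  -- multiplying by `R` leaves the projections on `s n`, which tend strongly to `1`.
  have hcauchy : CauchySeq fun n => T n x := by
    refine cauchySeq_of_norm_sq (E.measure x) (fun n => (hbd n).measurable)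
      (fun n t => norm_indicator_le_norm_self g t) hgi (g := g) (fun t => ?_)
      fun n m => ((hT n).sub (hbd n) (hbd m) (hT m)).norm_sq ((hbd n).sub (hbd m)) x
    refine tendsto_const_nhds.congr' ?_
    filter_upwards [hev t] with n hn
    simp [hn]
  obtain ⟨y, hy⟩ := cauchySeq_tendsto_of_complete hcauchy
  refine ⟨y, tendsto_nhds_unique ((R.continuous.tendsto y).comp hy) ?_⟩
  have hlim : BddTendsto (fun n => (s n).indicator fun _ => (1 : ℂ)) (fun _ => 1) := by
    refine ⟨fun n => measurable_const.indicator (hs n), ⟨1, fun n t => ?_⟩, fun t => ?_⟩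
    · exact (norm_indicator_le_norm_self _ _).trans (by simp)
    · refine tendsto_const_nhds.congr' ?_
      filter_upwards [hev t] with n hn
      simp [hn]
  have key := Represents.tendsto hlim (fun n => Represents.proj (E := E) (hs n)) Represents.one x
  have hRT : ∀ n, R * T n = E.proj (s n) := fun n => by
    refine (hR.mul (bddMeas_resFun hf hz) (hbd n) (hT n)).unique
      ((Represents.proj (hs n)).congr' fun t => ?_)
    by_cases ht : t ∈ s n
    · have := ofReal_sub_ne_zero hz (f t)
      simp [ht, resFun, g, this]
    · simp [ht]
  refine key.congr fun n => ?_
  rw [← hRT n]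
  rfl

theorem integral_norm_sq_mul {g : ℝ → ℂ} (hg : BddMeas g) {T : H →L[ℂ] H}
    (hT : E.Represents g T) (f : ℝ → ℝ) (x : H) :
    ∫ t, f t ∂(E.measure (T x)) = ∫ t, ‖g t‖ ^ 2 * f t ∂(E.measure x) := by
  rw [hT.measure_apply hg, integral_withDensity_eq_integral_toReal_smul
    ((hg.measurable.norm.pow_const 2).ennreal_ofReal) (ae_of_all _ fun t => ENNReal.ofReal_lt_top)]
  refine integral_congr_ae (ae_of_all _ fun t => ?_)
  simp only
  rw [ENNReal.toReal_ofReal (by positivity), smul_eq_mul]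

/-- The measure of `Ry` has density `|f - z|⁻²` with respect to that of `y`, and `f/(f - z) = 1 +
z/(f - z)` is bounded. -/
theorem memLp_of_resFun {f : ℝ → ℝ} (hf : Measurable f) {z : ℂ} (hz : z.im ≠ 0)
    {R : H →L[ℂ] H} (hR : E.Represents (resFun f z) R) (y : H) :
    MemLp f 2 (E.measure (R y)) := by
  have hb := bddMeas_resFun hf hz
  rw [memLp_two_iff_integrable_sq hf.aestronglyMeasurable, hR.measure_apply hb,
    integrable_withDensity_iff_integrable_smul' ((hb.measurable.norm.pow_const 2).ennreal_ofReal)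
      (ae_of_all _ fun t => ENNReal.ofReal_lt_top)]
  have h : BddMeas fun t => 1 + z * resFun f z t := (BddMeas.const 1).add (hb.const_mul z)
  refine ((h.star.mul h).integrable (E.measure y)).norm.congr (ae_of_all _ fun t => ?_)
  simp only
  rw [ENNReal.toReal_ofReal (by positivity), smul_eq_mul, norm_mul, RCLike.norm_conj]
  have h1 : 1 + z * resFun f z t = f t * resFun f z t := by
    have := ofReal_sub_ne_zero hz (f t)
    rw [resFun]; field_simp; ring
  rw [h1, norm_mul, Complex.norm_real, Real.norm_eq_abs]
  rw [← sq_abs (f t)]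
  ring

/-- The operator `∫ f dE`, built from its resolvent `R = ∫ (f - i)⁻¹ dE`. -/
def opOfRes (R : H →L[ℂ] H) (hR : Function.Injective (R : H →ₗ[ℂ] H)) : H →ₗ.[ℂ] H where
  domain := LinearMap.range (R : H →ₗ[ℂ] H)
  toFun := ((1 + Complex.I • R : H →L[ℂ] H) : H →ₗ[ℂ] H) ∘ₗ
    (LinearEquiv.ofInjective (R : H →ₗ[ℂ] H) hR).symm.toLinearMap

theorem opOfRes_apply {R : H →L[ℂ] H} (hR : Function.Injective (R : H →ₗ[ℂ] H)) (y : H)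
    (h : R y ∈ (opOfRes R hR).domain) :
    opOfRes R hR ⟨R y, h⟩ = y + Complex.I • R y := by
  have h1 : (⟨R y, h⟩ : LinearMap.range (R : H →ₗ[ℂ] H)) =
      LinearEquiv.ofInjective (R : H →ₗ[ℂ] H) hR y := rfl
  change ((1 + Complex.I • R : H →L[ℂ] H) : H →ₗ[ℂ] H)
    ((LinearEquiv.ofInjective (R : H →ₗ[ℂ] H) hR).symm ⟨R y, h⟩) = _
  rw [h1, LinearEquiv.symm_apply_apply]
  simp

/-- With `r = (f - i)⁻¹` one has `1 + ir = fr`, so the form `⟨Ry, y + iRy⟩` has symbol `f|r|²`, and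
`|r|²` is the density of the measure of `Ry`. -/
theorem isIntegral_opOfRes {f : ℝ → ℝ} (hf : Measurable f) {R : H →L[ℂ] H}
    (h : E.Represents (resFun f Complex.I) R) (hR : Function.Injective (R : H →ₗ[ℂ] H)) :
    E.IsIntegral f (opOfRes R hR) := by
  have hz : Complex.I.im ≠ 0 := by simp
  have hb := bddMeas_resFun hf hz
  refine ⟨fun x => ⟨?_, fun hx => exists_resFun_apply_eq hf hz h hx⟩, ?_⟩
  · rintro ⟨y, rfl⟩
    exact memLp_of_resFun hf hz h y
  · rintro ⟨x, y, rfl⟩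
    have hdom : R y ∈ (opOfRes R hR).domain := ⟨y, rfl⟩
    change ⟪R y, opOfRes R hR ⟨R y, hdom⟩⟫_ℂ = ((∫ t, f t ∂(E.measure (R y)) : ℝ) : ℂ)
    rw [opOfRes_apply hR y hdom, integral_norm_sq_mul hb h]
    have hsum := (Represents.one (E := E)).add (.const 1) (hb.const_mul Complex.I)
      (h.const_mul Complex.I)
    have hprod := h.star.mul hb.star ((BddMeas.const 1).add (hb.const_mul Complex.I)) hsum
    have key := hprod.inner y
    rw [mul_apply_eq_comp, ContinuousLinearMap.adjoint_inner_right] at key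
    simp only [add_apply, smul_apply, one_apply_eq_self] at key
    rw [key, ← integral_complex_ofReal]
    refine integral_congr_ae (ae_of_all _ fun t => ?_)
    have h0 := ofReal_sub_ne_zero hz (f t)
    have h1 : 1 + Complex.I * resFun f Complex.I t = f t * resFun f Complex.I t := by
      rw [resFun]; field_simp; ring
    simp only
    rw [h1, show ∀ a b c : ℂ, a * (b * c) = (c * a) * b from fun a b c => by ring, Complex.mul_conj,
      Complex.normSq_eq_norm_sq]
    push_cast
    ring

theorem injective_of_represents_resFun {f : ℝ → ℝ} (hf : Measurable f) {z : ℂ} (hz : z.im ≠ 0)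
    {R : H →L[ℂ] H} (h : E.Represents (resFun f z) R) :
    Function.Injective (R : H →ₗ[ℂ] H) := by
  rw [← LinearMap.ker_eq_bot, LinearMap.ker_eq_bot']
  intro x hx
  exact h.eq_zero_of_apply_eq_zero (bddMeas_resFun hf hz)
    (fun t => inv_ne_zero (ofReal_sub_ne_zero hz (f t))) hx

/-- The domain contains the range of `R`, whose orthogonal complement is the kernel of `R*`; the
symbol of `R*` has no zeros. -/
theorem dense_domain {f : ℝ → ℝ} (hf : Measurable f) {B : H →ₗ.[ℂ] H} (hB : E.IsIntegral f B) :
    Dense (B.domain : Set H) := by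
  have hz : Complex.I.im ≠ 0 := by simp
  have hb := bddMeas_resFun hf hz
  obtain ⟨R, hR⟩ := E.exists_represents hb
  have h1 : (LinearMap.range (R : H →ₗ[ℂ] H))ᗮ = ⊥ := by
    rw [ContinuousLinearMap.orthogonal_range, LinearMap.ker_eq_bot']
    intro x hx
    refine hR.star.eq_zero_of_apply_eq_zero hb.star (fun t => ?_) hx
    have := inv_ne_zero (ofReal_sub_ne_zero hz (f t))
    rw [resFun]
    exact (map_ne_zero _).mpr this
  have h2 := Submodule.topologicalClosure_eq_top_iff.mpr h1
  refine (Submodule.dense_iff_topologicalClosure_eq_top.mpr h2).mono ?_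
  rintro _ ⟨y, rfl⟩
  exact (hB.1 _).mpr (memLp_of_resFun hf hz hR y)

/-- The difference has zero quadratic form on the common domain. Polarisation makes its values
orthogonal to that domain, which is dense. -/
theorem IsIntegral.unique {f : ℝ → ℝ} {B B' : H →ₗ.[ℂ] H} (hB : E.IsIntegral f B)
    (hB' : E.IsIntegral f B') (hd : Dense (B.domain : Set H)) : B = B' := by
  have hdom : B.domain = B'.domain := by
    ext x
    rw [hB.1, hB'.1]
  let C : B.domain →ₗ[ℂ] H := B.toFun - B'.toFun ∘ₗ Submodule.inclusion hdom.le
  have hC : ∀ x, C x = B x - B' ⟨x, hdom ▸ x.2⟩ := fun x => rfl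
  have h0 : ∀ x : B.domain, ⟪(x : H), C x⟫_ℂ = 0 := fun x => by
    rw [hC, inner_sub_right, hB.2 x, hB'.2 ⟨x, hdom ▸ x.2⟩, sub_self]
  have h1 : ∀ x y : B.domain, ⟪(x : H), C y⟫_ℂ = 0 := fun x y => by
    have a1 := h0 (x + y)
    have a2 := h0 (x + Complex.I • y)
    simp only [map_add, map_smul, Submodule.coe_add, Submodule.coe_smul, inner_add_left,
      inner_add_right, inner_smul_left, inner_smul_right, h0, Complex.conj_I] at a1 a2
    have a3 : Complex.I * (⟪(x : H), C y⟫_ℂ - ⟪(y : H), C x⟫_ℂ) = 0 := by linear_combination a2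
    have a4 := (mul_eq_zero.mp a3).resolve_left Complex.I_ne_zero
    have a5 : 2 * ⟪(x : H), C y⟫_ℂ = 0 := by linear_combination a1 + a4
    exact (mul_eq_zero.mp a5).resolve_left two_ne_zero
  refine LinearPMap.ext hdom fun x hx hx' => ?_
  have h2 : C ⟨x, hx⟩ = 0 := hd.eq_zero_of_inner_right (𝕜 := ℂ) fun v hv => h1 ⟨v, hv⟩ ⟨x, hx⟩
  exact sub_eq_zero.mp h2

theorem IsIntegral.congr {f g : ℝ → ℝ} {B : H →ₗ.[ℂ] H} (hB : E.IsIntegral f B)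
    (h : ∀ x, f =ᵐ[E.measure x] g) : E.IsIntegral g B :=
  ⟨fun x => by rw [hB.1, memLp_congr_ae (h x)],
    fun x => by rw [hB.2, integral_congr_ae (h x)]⟩

theorem exists_isIntegral (E : PVM H) {f : ℝ → ℝ} (hf : Measurable f) :
    ∃ B, E.IsIntegral f B := by
  obtain ⟨R, hR⟩ := E.exists_represents (bddMeas_resFun hf (z := Complex.I) (by simp))
  exact ⟨_, isIntegral_opOfRes hf hR (injective_of_represents_resFun hf (by simp) hR)⟩

theorem resFun_identity (f : ℝ → ℝ) {z w : ℂ} (hz : z.im ≠ 0) (hw : w.im ≠ 0) (t : ℝ) :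
    resFun f w t * (1 + (z - w) * resFun f z t) = resFun f z t := by
  have h1 := ofReal_sub_ne_zero hz (f t)
  have h2 := ofReal_sub_ne_zero hw (f t)
  rw [resFun, resFun]
  field_simp
  ring

theorem resFun_mul_comm_identity {f : ℝ → ℝ} (hf : Measurable f) {z w : ℂ} (hz : z.im ≠ 0)
    (hw : w.im ≠ 0) {R S : H →L[ℂ] H} (hR : E.Represents (resFun f z) R)
    (hS : E.Represents (resFun f w) S) (x : H) : S (x + (z - w) • R x) = R x := by
  have hb := bddMeas_resFun hf hz
  have h1 := hS.mul (bddMeas_resFun hf hw) ((BddMeas.const 1).add (hb.const_mul (z - w)))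
    ((Represents.one (E := E)).add (.const 1) (hb.const_mul (z - w)) (hR.const_mul (z - w)))
  have h2 := (h1.congr' (resFun_identity f hz hw)).unique hR
  exact congrArg (fun F : H →L[ℂ] H => F x) h2

/-- By uniqueness `B` is the operator built from the resolvent `S` at `i`. The resolvent identity
moves from `i` to `z`: it writes `Rx` as a value of `S`, hence as an element of the domain. -/
theorem IsIntegral.isResolventAt {f : ℝ → ℝ} (hf : Measurable f) {B : H →ₗ.[ℂ] H}
    (hB : E.IsIntegral f B) {z : ℂ} (hz : z.im ≠ 0) {R : H →L[ℂ] H}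
    (hR : E.Represents (resFun f z) R) : IsResolventAt B z R := by
  have hI : Complex.I.im ≠ 0 := by simp
  obtain ⟨S, hS⟩ := E.exists_represents (bddMeas_resFun hf hI)
  have hinj := injective_of_represents_resFun hf hI hS
  obtain rfl : B = opOfRes S hinj := hB.unique (isIntegral_opOfRes hf hS hinj) (dense_domain hf hB)
  refine ⟨fun x => ?_, ?_⟩
  · have h1 := resFun_mul_comm_identity hf hz hI hR hS x
    have hx : R x ∈ (opOfRes S hinj).domain := ⟨_, h1⟩
    refine ⟨hx, ?_⟩
    have h2 := opOfRes_apply hinj (x + (z - Complex.I) • R x) ⟨_, rfl⟩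
    simp only [h1] at h2
    rw [h2]
    module
  · rintro ⟨_, y, rfl⟩
    have hdom : S y ∈ (opOfRes S hinj).domain := ⟨y, rfl⟩
    change R (opOfRes S hinj ⟨S y, hdom⟩ - z • S y) = S y
    rw [opOfRes_apply hinj y hdom]
    refine Eq.trans (congrArg R ?_) (resFun_mul_comm_identity hf hI hz hS hR y)
    module

/-! ### The support of the spectral measure -/

/-- On the range of `E((t - ε, t + ε))` the operator `A - t` has norm at most `ε`, while its inverse
`Q` is bounded; for `ε‖Q‖ < 1` the range is therefore zero. Locally null sets are null. -/
theorem IsIntegral.measure_compl_spec {A : H →ₗ.[ℂ] H} (hA : E.IsIntegral (fun t => t) A) (x : H) :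
    E.measure x {t : ℝ | (t : ℂ) ∉ spec A} = 0 := by
  refine measure_null_of_locally_null _ fun t ht => ?_
  obtain ⟨Q, hQ⟩ : (t : ℂ) ∈ resSet A := not_not.mp ht
  let ε : ℝ := (‖Q‖ + 1)⁻¹
  have hε : 0 < ε := by positivity
  let s : Set ℝ := Ioo (t - ε) (t + ε)
  have hs : MeasurableSet s := measurableSet_Ioo
  refine ⟨s, mem_nhdsWithin_of_mem_nhds (Ioo_mem_nhds (by linarith) (by linarith)), ?_⟩
  have hI : Complex.I.im ≠ 0 := by simp
  have hf : Measurable fun t : ℝ => t := measurable_id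
  have hr := bddMeas_resFun hf hI
  obtain ⟨S, hS⟩ := E.exists_represents hr
  have hinj := injective_of_represents_resFun hf hI hS
  obtain rfl : A = opOfRes S hinj := hA.unique (isIntegral_opOfRes hf hS hinj) (dense_domain hf hA)
  -- This is the symbol of `(A - t)E(s)`.
  let k : ℝ → ℂ := s.indicator fun u => ((u - t : ℝ) : ℂ)
  have hkb : ∀ u, ‖k u‖ ≤ ε := fun u => by
    by_cases hu : u ∈ s
    · rw [show k u = ((u - t : ℝ) : ℂ) by simp [k, hu], Complex.norm_real, Real.norm_eq_abs, abs_le]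
      constructor <;> linarith [hu.1, hu.2]
    · simp [k, hu, hε.le]
  have hk : BddMeas k := ⟨(Complex.measurable_ofReal.comp (measurable_id.sub_const t)).indicator hs,
    ε, hkb⟩
  obtain ⟨T, hT⟩ := E.exists_represents hk
  have h1s : BddMeas (s.indicator fun _ => (1 : ℂ)) := (BddMeas.const 1).indicator hs
  have hP := Represents.proj (E := E) hs
  set P := E.proj s with hPdef
  have hgP : E.Represents (fun u => k u + ((t : ℂ) - Complex.I) * s.indicator (fun _ => (1 : ℂ)) u)
      (T + ((t : ℂ) - Complex.I) • P) :=
    hT.add hk (h1s.const_mul _) (hP.const_mul _)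
  -- The bracket has symbol `u - i` on `s`. The identity puts `Px` in the domain of `A` and yields
  -- `(A - t)Px = Tx`.
  have hSP : S * (T + ((t : ℂ) - Complex.I) • P) = P := by
    refine ((hS.mul hr (hk.add (h1s.const_mul _)) hgP).congr' fun u => ?_).unique hP
    by_cases hu : u ∈ s
    · have h0 := ofReal_sub_ne_zero hI u
      simp only [k, resFun, hu, indicator_of_mem]
      push_cast
      field_simp
      ring
    · simp [k, hu]
  have hxP : S (T x + ((t : ℂ) - Complex.I) • P x) = P x :=
    congrArg (fun F : H →L[ℂ] H => F x) hSP
  have hdom : P x ∈ (opOfRes S hinj).domain := ⟨_, hxP⟩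
  have h2 := opOfRes_apply hinj (T x + ((t : ℂ) - Complex.I) • P x) ⟨_, rfl⟩
  simp only [hxP] at h2
  have h3 : Q (T x) = P x := by
    have h4 : Q (opOfRes S hinj ⟨P x, hdom⟩ - (t : ℂ) • P x) = P x := hQ.2 ⟨P x, hdom⟩
    rw [h2] at h4
    rw [← h4]
    congr 1
    module
  have hTP : T (P x) = T x := by
    have : T * P = T := by
      refine ((hT.mul hk h1s hP).congr' fun u => ?_).unique hT
      by_cases hu : u ∈ s <;> simp [k, hu]
    exact congrArg (fun F : H →L[ℂ] H => F x) this
  have hTn : ‖T‖ ≤ ε := hT.norm_le hk hε.le fun y => ae_of_all _ hkb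
  have h5 : ‖P x‖ ≤ ‖Q‖ * (ε * ‖P x‖) := by
    calc ‖P x‖ = ‖Q (T (P x))‖ := by rw [hTP, h3]
      _ ≤ ‖Q‖ * ‖T (P x)‖ := Q.le_opNorm _
      _ ≤ ‖Q‖ * (ε * ‖P x‖) := by
        gcongr
        exact (T.le_opNorm _).trans (by gcongr)
  have h6 : ‖Q‖ * ε < 1 := by
    rw [← div_eq_mul_inv, div_lt_one (by positivity)]
    linarith
  have h7 : ‖P x‖ = 0 := by
    by_contra hne
    have hpos : 0 < ‖P x‖ := lt_of_le_of_ne (norm_nonneg _) (Ne.symm hne)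
    nlinarith
  rw [E.measure_apply x hs, ← hPdef, h7]
  simp

end PVM

/-! ### The metric of `X_∞` -/

theorem bddAbove_nu_set (n : ℤ) (f : XTilde) :
    BddAbove ({0} ∪ {θ : ℝ | ∃ t : Angle, (t : ℝ) = θ ∧ n < f.1 t}) := by
  refine ⟨2 * Real.pi, ?_⟩
  rintro θ (rfl | ⟨t, rfl, -⟩)
  · positivity
  · exact t.2.2.le

theorem nu_nonneg (n : ℤ) (f : XTilde) : 0 ≤ nu n f :=
  le_csSup (bddAbove_nu_set n f) (Or.inl rfl)

theorem le_nu {n : ℤ} {f : XTilde} {t : Angle} (h : n < f.1 t) : (t : ℝ) ≤ nu n f :=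
  le_csSup (bddAbove_nu_set n f) (Or.inr ⟨t, rfl, h⟩)

theorem nu_le {n : ℤ} {f : XTilde} {c : ℝ} (hc : 0 ≤ c) (h : ∀ t : Angle, n < f.1 t → (t : ℝ) ≤ c) :
    nu n f ≤ c := by
  refine csSup_le ⟨0, Or.inl rfl⟩ ?_
  rintro θ (rfl | ⟨t, rfl, ht⟩)
  · exact hc
  · exact h t ht

theorem nu_le_two_pi (n : ℤ) (f : XTilde) : nu n f ≤ 2 * Real.pi :=
  nu_le (by positivity) fun t _ => t.2.2.le

theorem bddAbove_rhoTilde (f g : XTilde) : BddAbove (range fun n : ℤ => |nu n f - nu n g|) := by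
  refine ⟨2 * Real.pi, ?_⟩
  rintro _ ⟨n, rfl⟩
  simp only
  rw [abs_le]
  constructor <;> linarith [nu_nonneg n f, nu_nonneg n g, nu_le_two_pi n f, nu_le_two_pi n g]

theorem abs_nu_sub_le (f g : XTilde) (n : ℤ) : |nu n f - nu n g| ≤ rhoTilde f g :=
  le_ciSup (bddAbove_rhoTilde f g) n

theorem rhoTilde_le {f g : XTilde} {c : ℝ} (h : ∀ n, |nu n f - nu n g| ≤ c) : rhoTilde f g ≤ c :=
  ciSup_le h

theorem rhoTilde_nonneg (f g : XTilde) : 0 ≤ rhoTilde f g :=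
  (abs_nonneg _).trans (abs_nu_sub_le f g 0)

theorem rhoTilde_comm (f g : XTilde) : rhoTilde f g = rhoTilde g f := by
  simp only [rhoTilde, abs_sub_comm]

theorem rhoTilde_triangle (f g h : XTilde) : rhoTilde f h ≤ rhoTilde f g + rhoTilde g h :=
  rhoTilde_le fun n => (abs_sub_le _ (nu n g) _).trans
    (add_le_add (abs_nu_sub_le f g n) (abs_nu_sub_le g h n))

/-- The translate of `f` by an integer. -/
def shift (k : ℤ) (f : XTilde) : XTilde :=
  ⟨fun θ => f.1 θ + k, fun _ _ h => add_le_add_left (f.2.1 h) k,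
    fun θ => (f.2.2 θ).add continuousWithinAt_const⟩

theorem mk_shift (k : ℤ) (f : XTilde) : (⟦shift k f⟧ : XInf) = ⟦f⟧ :=
  Quotient.sound ⟨k, fun _ => rfl⟩

theorem exists_shift {f g : XTilde} (h : (⟦f⟧ : XInf) = ⟦g⟧) : ∃ k, f = shift k g := by
  obtain ⟨k, hk⟩ := Quotient.exact h
  exact ⟨k, Subtype.ext (funext hk)⟩

theorem nu_shift (n k : ℤ) (f : XTilde) : nu n (shift k f) = nu (n - k) f := by
  simp only [nu, shift, sub_lt_iff_lt_add]

theorem rhoTilde_shift (k : ℤ) (f g : XTilde) :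
    rhoTilde (shift k f) (shift k g) = rhoTilde f g := by
  apply le_antisymm
  · refine rhoTilde_le fun n => ?_
    rw [nu_shift, nu_shift]
    exact abs_nu_sub_le f g _
  · refine rhoTilde_le fun n => ?_
    have := abs_nu_sub_le (shift k f) (shift k g) (n + k)
    rwa [nu_shift, nu_shift, add_sub_cancel_right] at this

theorem shift_shift (k m : ℤ) (f : XTilde) : shift k (shift m f) = shift (m + k) f :=
  Subtype.ext (funext fun _ => add_assoc _ _ _)

theorem rho_le (f g : XTilde) : rho ⟦f⟧ ⟦g⟧ ≤ rhoTilde f g := by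
  refine csInf_le ⟨0, ?_⟩ ⟨f, g, rfl, rfl, rfl⟩
  rintro _ ⟨f', g', -, -, rfl⟩
  exact rhoTilde_nonneg _ _

theorem rho_nonneg (f g : XInf) : 0 ≤ rho f g := by
  refine Real.sInf_nonneg ?_
  rintro _ ⟨f', g', -, -, rfl⟩
  exact rhoTilde_nonneg _ _

/-- Simultaneous shifts preserve `rhoTilde`, so one of the two representatives can be kept fixed in
the infimum. -/
theorem exists_rhoTilde_shift_lt (f g : XTilde) {c : ℝ} (h : rho ⟦f⟧ ⟦g⟧ < c) :
    ∃ k, rhoTilde f (shift k g) < c := by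
  obtain ⟨_, ⟨f', g', hf, hg, rfl⟩, hlt⟩ := exists_lt_of_csInf_lt
    (⟨rhoTilde f g, f, g, rfl, rfl, rfl⟩ : {r : ℝ | ∃ f' g' : XTilde, (⟦f'⟧ : XInf) = ⟦f⟧ ∧
      (⟦g'⟧ : XInf) = ⟦g⟧ ∧ r = rhoTilde f' g'}.Nonempty) h
  obtain ⟨a, rfl⟩ := exists_shift hf
  obtain ⟨b, rfl⟩ := exists_shift hg
  refine ⟨b - a, ?_⟩
  rw [← rhoTilde_shift a, shift_shift, sub_add_cancel]
  exact hlt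

theorem rho_comm (f g : XInf) : rho f g = rho g f := by
  unfold rho
  congr 1
  ext r
  constructor
  · rintro ⟨a, b, ha, hb, rfl⟩
    exact ⟨b, a, hb, ha, rhoTilde_comm a b⟩
  · rintro ⟨a, b, ha, hb, rfl⟩
    exact ⟨b, a, hb, ha, rhoTilde_comm a b⟩

theorem rho_triangle (f g h : XInf) : rho f h ≤ rho f g + rho g h := by
  induction f using Quotient.inductionOn with | _ f
  induction g using Quotient.inductionOn with | _ g
  induction h using Quotient.inductionOn with | _ h
  refine le_of_forall_pos_le_add fun ε hε => ?_
  obtain ⟨k, hk⟩ := exists_rhoTilde_shift_lt f g (c := rho ⟦f⟧ ⟦g⟧ + ε / 2) (by linarith)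
  obtain ⟨m, hm⟩ := exists_rhoTilde_shift_lt g h (c := rho ⟦g⟧ ⟦h⟧ + ε / 2) (by linarith)
  have h1 := rho_le f (shift k (shift m h))
  rw [mk_shift, mk_shift] at h1
  have h2 := rhoTilde_triangle f (shift k g) (shift k (shift m h))
  rw [rhoTilde_shift] at h2
  linarith

/-- An integer-valued left continuous function is constant just to the left of each point. Hence `t
≤ ν(n; f)` is equivalent to `n < f(t)`, and `ν` recovers `f`. -/
theorem eq_of_nu_eq {f g : XTilde} (h : ∀ n, nu n f = nu n g) : f = g := by
  have key : ∀ (f : XTilde) (n : ℤ) (t : Angle), (t : ℝ) ≤ nu n f → n < f.1 t := by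
    intro f n t ht
    by_contra! hn
    have h1 : ∀ᶠ s in 𝓝[≤] t, f.1 s = f.1 t :=
      (f.2.2 t).eventually (p := fun m => m = f.1 t) (by rw [nhds_discrete]; exact eventually_pure.mpr rfl)
    obtain ⟨s, hst, hs⟩ : ∃ s : Angle, s < t ∧ f.1 s = f.1 t := by
      have ht0 := t.2.1
      have hlt : (⟨(t : ℝ) / 2, by simp only [mem_Ioo]; constructor <;> linarith [t.2.2]⟩ : Angle) < t :=
        show (t : ℝ) / 2 < t by linarith
      obtain ⟨l, hl, hsub⟩ := (mem_nhdsLE_iff_exists_Ioc_subset' hlt).mp h1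
      have hlt' : (l : ℝ) < t := hl
      obtain ⟨r, hr1, hr2⟩ := exists_between hlt'
      exact ⟨⟨r, l.2.1.trans hr1, hr2.trans t.2.2⟩, hr2, hsub ⟨hr1, hr2.le⟩⟩
    have h2 : nu n f ≤ s := by
      refine nu_le s.2.1.le fun r hr => ?_
      by_contra! hsr
      have := f.2.1 (show s ≤ r from hsr.le)
      linarith
    have : (s : ℝ) < t := hst
    linarith
  refine Subtype.ext (funext fun t => le_antisymm ?_ ?_)
  · by_contra! hlt
    exact (key g _ t (h (g.1 t) ▸ le_nu hlt)).false
  · by_contra! hlt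
    exact (key f _ t (h (f.1 t) ▸ le_nu hlt)).false

theorem antitone_nu (f : XTilde) : Antitone fun n => nu n f := fun _ _ hmn =>
  nu_le (nu_nonneg _ f) fun _ ht => le_nu (hmn.trans_lt ht)

theorem exists_nu_step (f : XTilde) : ∃ m : ℤ, nu (m + 1) f < nu m f := by
  by_contra! hc
  have h1 : ∀ m : ℤ, nu (m + 1) f = nu m f := fun m =>
    le_antisymm (antitone_nu f (by omega)) (hc m)
  have h2 : ∀ m : ℤ, nu m f = nu 0 f := fun m => by
    induction m using Int.induction_on with
    | zero => rfl
    | succ i hi => rw [h1, hi]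
    | pred i hi => rw [← hi, ← h1 (-(i : ℤ) - 1), sub_add_cancel]
  have hpi := Real.pi_pos
  -- Any point beyond `π` would do: a constant `ν` would be at most `π` and at least `u`.
  let u : Angle := ⟨3 * Real.pi / 2, by positivity, by linarith⟩
  have h3 : nu (f.1 angPi) f ≤ Real.pi := nu_le hpi.le fun t ht => by
    by_contra! hlt
    have := f.2.1 (show angPi ≤ t from hlt.le)
    linarith
  have h4 : 3 * Real.pi / 2 ≤ nu (f.1 u - 1) f := le_nu (t := u) (by omega)
  rw [h2] at h3 h4
  linarith

/-- Let `J` be the size of a step of `ν(·; g)`. Two different shifts of `g` cannot both be within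
`J/2` of `f`, so all sufficiently good shifts are the same one, and the infimum `0` is attained. -/
theorem eq_of_rho_eq_zero {f g : XInf} (h : rho f g = 0) : f = g := by
  induction f using Quotient.inductionOn with | _ f
  induction g using Quotient.inductionOn with | _ g
  obtain ⟨m, hm⟩ := exists_nu_step g
  set J := nu m g - nu (m + 1) g with hJ
  have hJ0 : 0 < J := by linarith
  have huniq : ∀ k k' : ℤ, k < k' → rhoTilde f (shift k g) < J / 2 →
      rhoTilde f (shift k' g) < J / 2 → False := by
    intro k k' hkk hk hk'
    -- At this index the shift by `k` sits at the lower end of the step of `g`, and the shift by the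
    -- larger `k'` at or above its upper end.
    have h1 := abs_lt.mp ((abs_nu_sub_le f (shift k g) (m + 1 + k)).trans_lt hk)
    have h2 := abs_lt.mp ((abs_nu_sub_le f (shift k' g) (m + 1 + k)).trans_lt hk')
    rw [nu_shift, add_sub_cancel_right] at h1
    rw [nu_shift] at h2
    have h3 : nu m g ≤ nu (m + 1 + k - k') g := antitone_nu g (by omega)
    linarith
  have hex : ∀ c, 0 < c → ∃ k, rhoTilde f (shift k g) < c := fun c hc =>
    exists_rhoTilde_shift_lt f g (h ▸ hc)
  obtain ⟨k, hk⟩ := hex (J / 2) (by linarith)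
  have h0 : rhoTilde f (shift k g) ≤ 0 := by
    refine le_of_forall_pos_le_add fun ε hε => ?_
    obtain ⟨k', hk'⟩ := hex (min (J / 2) ε) (by positivity)
    have hk'1 := hk'.trans_le (min_le_left _ _)
    have hk'2 := hk'.trans_le (min_le_right _ _)
    rcases lt_trichotomy k k' with hlt | rfl | hlt
    · exact (huniq _ _ hlt hk hk'1).elim
    · linarith
    · exact (huniq _ _ hlt hk'1 hk).elim
  have : f = shift k g := eq_of_nu_eq fun n => by
    have := (abs_nu_sub_le f (shift k g) n).trans h0
    exact sub_eq_zero.mp (abs_nonpos_iff.mp this)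
  rw [this, mk_shift]

theorem XLimit.unique {u : ℝ → XInf} {L L' : XInf} (h : XLimit u L) (h' : XLimit u L') :
    L = L' := by
  refine eq_of_rho_eq_zero (le_antisymm ?_ (rho_nonneg _ _))
  have h1 : Tendsto (fun y => rho (u y) L + rho (u y) L') (𝓝[>] (0 : ℝ)) (𝓝 (0 + 0)) := h.add h'
  rw [add_zero] at h1
  refine ge_of_tendsto h1 (Eventually.of_forall fun y => ?_)
  rw [rho_comm (u y) L]
  exact rho_triangle _ _ _

/-- Two non-increasing functions which dominate each other after a translation of the argument by
`δ` are at distance at most `δ`. -/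
theorem rhoTilde_le_of_shifted {f g : XTilde} {δ : ℝ} (hδ : 0 ≤ δ)
    (h1 : ∀ s t : Angle, (t : ℝ) = s + δ → f.1 t ≤ g.1 s)
    (h2 : ∀ s t : Angle, (t : ℝ) = s + δ → g.1 t ≤ f.1 s) : rhoTilde f g ≤ δ := by
  have key : ∀ f g : XTilde, (∀ s t : Angle, (t : ℝ) = s + δ → f.1 t ≤ g.1 s) → ∀ n,
      nu n f ≤ nu n g + δ := by
    intro f g h n
    refine nu_le (by linarith [nu_nonneg n g]) fun t ht => ?_
    -- There is no angle `t - δ` when `t ≤ δ`; then `ν ≥ 0` suffices, which is the role of the point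
    -- `0` in the definition of `nu`.
    rcases le_or_gt (t : ℝ) δ with htδ | htδ
    · linarith [nu_nonneg n g]
    · let s : Angle := ⟨t - δ, by linarith, by linarith [t.2.2]⟩
      have h3 : (t : ℝ) = (s : ℝ) + δ := by simp [s]
      have h4 := le_nu (ht.trans_le (h s t h3))
      linarith
  refine rhoTilde_le fun n => abs_le.mpr ⟨?_, ?_⟩
  · linarith [key g f h2 n]
  · linarith [key f g h1 n]

/-! ### Stability of the ranks of the spectral projections -/

/-- The quadratic form of a compact self-adjoint operator is bounded by any `c ≥ 0` which
dominates its eigenvalues. -/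
theorem re_inner_le_of_hasEigenvalue_le {K : H →L[ℂ] H} (hK : IsSelfAdjoint K)
    (hc : IsCompactOperator K) {c : ℝ} (hc0 : 0 ≤ c)
    (hev : ∀ m : ℝ, c < m → ¬ Module.End.HasEigenvalue (K : H →ₗ[ℂ] H) (m : ℂ)) (x : H) :
    (⟪x, K x⟫_ℂ).re ≤ c * ‖x‖ ^ 2 := by
  have hsa : IsSelfAdjoint (algebraMap ℝ (H →L[ℂ] H) c - K) :=
    (IsSelfAdjoint.algebraMap _ (IsSelfAdjoint.all c)).sub hK
  have hnn : 0 ≤ algebraMap ℝ (H →L[ℂ] H) c - K := by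
    rw [StarOrderedRing.nonneg_iff_spectrum_nonneg (R := ℝ) _ hsa]
    intro t ht
    by_contra! hneg
    rw [spectrum.mem_iff] at ht
    have h2 : c - t ∈ spectrum ℝ K := by
      rw [spectrum.mem_iff]
      intro h
      apply ht
      have := h.neg
      convert this using 1
      rw [map_sub]
      abel
    rw [← spectrum.algebraMap_mem_iff ℂ] at h2
    refine hev (c - t) (by linarith) ((hc.hasEigenvalue_iff_mem_spectrum ?_).mpr h2)
    exact_mod_cast (show c - t ≠ 0 by linarith)
  have h := ((ContinuousLinearMap.nonneg_iff_isPositive _).mp hnn).inner_nonneg_right x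
  have h3 : (algebraMap ℝ (H →L[ℂ] H) c - K) x = (c : ℂ) • x - K x := by
    simp [Algebra.algebraMap_eq_smul_one]
  rw [h3, inner_sub_right, inner_smul_right, inner_self_eq_norm_sq_to_K] at h
  have h4 := (Complex.le_def.mp h).1
  simp at h4
  norm_cast at h4

/-- The self-adjoint operator `(exp(-iφ) W + exp(iφ) W*) / 2`. -/
def cosOp (W : H →L[ℂ] H) (φ : ℝ) : H →L[ℂ] H :=
  (1 / 2 : ℂ) • (Complex.exp ((-φ : ℝ) * Complex.I) • W +
    Complex.exp ((φ : ℝ) * Complex.I) • ContinuousLinearMap.adjoint W)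

theorem conj_exp_ofReal_mul_I (φ : ℝ) :
    (starRingEnd ℂ) (Complex.exp (φ * Complex.I)) = Complex.exp ((-φ : ℝ) * Complex.I) := by
  rw [← Complex.exp_conj]
  congr 1
  simp

theorem isSelfAdjoint_cosOp (W : H →L[ℂ] H) (φ : ℝ) : IsSelfAdjoint (cosOp W φ) := by
  rw [IsSelfAdjoint, cosOp, star_smul, star_add, star_smul, star_smul,
    ← ContinuousLinearMap.star_eq_adjoint, star_star]
  have h1 : star (Complex.exp ((-φ : ℝ) * Complex.I)) = Complex.exp (φ * Complex.I) := by
    have := conj_exp_ofReal_mul_I (-φ)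
    rwa [neg_neg] at this
  have h2 : star (Complex.exp (φ * Complex.I)) = Complex.exp ((-φ : ℝ) * Complex.I) :=
    conj_exp_ofReal_mul_I φ
  have h3 : star (1 / 2 : ℂ) = 1 / 2 := by simp
  rw [h1, h2, h3, add_comm]

theorem re_inner_cosOp (W : H →L[ℂ] H) (φ : ℝ) (x : H) :
    (⟪x, cosOp W φ x⟫_ℂ).re = (Complex.exp ((-φ : ℝ) * Complex.I) * ⟪x, W x⟫_ℂ).re := by
  have h : ⟪x, cosOp W φ x⟫_ℂ = (1 / 2 : ℂ) * (Complex.exp ((-φ : ℝ) * Complex.I) * ⟪x, W x⟫_ℂ +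
      (starRingEnd ℂ) (Complex.exp ((-φ : ℝ) * Complex.I) * ⟪x, W x⟫_ℂ)) := by
    simp only [cosOp, smul_apply, add_apply, inner_smul_right, inner_add_right,
      ContinuousLinearMap.adjoint_inner_right, map_mul, inner_conj_symm, conj_exp_ofReal_mul_I,
      neg_neg]
  rw [h, Complex.add_conj]
  simp

theorem re_inner_cosOp_sub_le (W W' : H →L[ℂ] H) (φ : ℝ) (x : H) :
    (⟪x, cosOp W φ x⟫_ℂ).re ≤ (⟪x, cosOp W' φ x⟫_ℂ).re + ‖W - W'‖ * ‖x‖ ^ 2 := by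
  rw [re_inner_cosOp, re_inner_cosOp]
  have h1 : (Complex.exp ((-φ : ℝ) * Complex.I) * ⟪x, W x⟫_ℂ).re -
      (Complex.exp ((-φ : ℝ) * Complex.I) * ⟪x, W' x⟫_ℂ).re ≤ ‖W - W'‖ * ‖x‖ ^ 2 := by
    rw [← Complex.sub_re, ← mul_sub, ← inner_sub_right]
    refine (Complex.re_le_norm _).trans ?_
    rw [norm_mul, Complex.norm_exp_ofReal_mul_I, one_mul]
    calc ‖⟪x, W x - W' x⟫_ℂ‖ ≤ ‖x‖ * ‖(W - W') x‖ := norm_inner_le_norm _ _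
      _ ≤ ‖x‖ * (‖W - W'‖ * ‖x‖) := by gcongr; exact (W - W').le_opNorm x
      _ = ‖W - W'‖ * ‖x‖ ^ 2 := by ring
  linarith

/-! ### Spectral subspaces of arcs and the form of `cosOp` -/

theorem adjoint_apply_of_eigenvector {W : H →L[ℂ] H} (hW : W ∈ unitary (H →L[ℂ] H)) {w : ℂ}
    (hw : ‖w‖ = 1) {v : H} (hv : W v = w • v) :
    ContinuousLinearMap.adjoint W v = (starRingEnd ℂ) w • v := by
  have h1 : ContinuousLinearMap.adjoint W (W v) = v :=
    congrArg (fun T : H →L[ℂ] H => T v) (Unitary.star_mul_self_of_mem hW)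
  rw [hv, map_smul] at h1
  have h2 : (starRingEnd ℂ) w * w = 1 := by
    rw [mul_comm, Complex.mul_conj, Complex.normSq_eq_norm_sq, hw]; simp
  nth_rewrite 2 [← h1]
  rw [smul_smul, h2, one_smul]

theorem cosOp_apply_of_eigenvector {W : H →L[ℂ] H} (hW : W ∈ unitary (H →L[ℂ] H)) {θ φ : ℝ}
    {v : H} (hv : W v = Complex.exp (θ * Complex.I) • v) :
    cosOp W φ v = ((Real.cos (θ - φ) : ℝ) : ℂ) • v := by
  have h1 := adjoint_apply_of_eigenvector hW (Complex.norm_exp_ofReal_mul_I θ) hv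
  simp only [cosOp, smul_apply, add_apply]
  rw [h1, hv, smul_smul, smul_smul, ← add_smul, smul_smul, conj_exp_ofReal_mul_I, ← Complex.exp_add,
    ← Complex.exp_add, Complex.ofReal_cos, Complex.cos]
  congr 1
  rw [show ((-φ : ℝ) : ℂ) * Complex.I + θ * Complex.I = ((θ - φ : ℝ) : ℂ) * Complex.I by
      push_cast; ring,
    show (φ : ℂ) * Complex.I + ((-θ : ℝ) : ℂ) * Complex.I = -((θ - φ : ℝ) : ℂ) * Complex.I by
      push_cast; ring]
  ring

/-- The scalar `cos φ` is the value of `cosOp` at `W = 1`, and `W* - 1 = -W*(W - 1)` is compact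
along with `W - 1`. -/
theorem isCompactOperator_cosOp_sub {W : H →L[ℂ] H} (hW : W ∈ YInf H) (φ : ℝ) :
    IsCompactOperator (cosOp W φ - (Real.cos φ : ℂ) • (1 : H →L[ℂ] H)) := by
  have h1 : ContinuousLinearMap.adjoint W - 1 = -(ContinuousLinearMap.adjoint W * (W - 1)) := by
    have : ContinuousLinearMap.adjoint W * W = 1 := Unitary.star_mul_self_of_mem hW.1
    rw [mul_sub, this, mul_one, neg_sub]
  have h2 : IsCompactOperator (ContinuousLinearMap.adjoint W - 1 : H →L[ℂ] H) := by
    rw [h1]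
    exact (hW.2.clm_comp (ContinuousLinearMap.adjoint W)).neg
  have h3 : cosOp W φ - (Real.cos φ : ℂ) • (1 : H →L[ℂ] H) =
      (1 / 2 : ℂ) • (Complex.exp ((-φ : ℝ) * Complex.I) • (W - 1) +
        Complex.exp ((φ : ℝ) * Complex.I) • (ContinuousLinearMap.adjoint W - 1)) := by
    rw [cosOp, Complex.ofReal_cos, Complex.cos]
    push_cast
    simp only [smul_sub, smul_add, smul_smul, neg_mul]
    module
  rw [h3]
  exact ((hW.2.smul _).add (h2.smul _)).smul _

theorem orthogonalFamily_arc {W : H →L[ℂ] H} (hW : W ∈ unitary (H →L[ℂ] H)) {a b : ℝ} (ha : 0 < a)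
    (hb : b < 2 * Real.pi) :
    OrthogonalFamily ℂ (fun θ : Set.Ico a b => Module.End.eigenspace (W : H →ₗ[ℂ] H)
      (Complex.exp (((θ : ℝ) : ℂ) * Complex.I))) (fun θ => (Module.End.eigenspace (W : H →ₗ[ℂ] H)
      (Complex.exp (((θ : ℝ) : ℂ) * Complex.I))).subtypeₗᵢ) := by
  intro s t hst u w
  refine eigenspace_orthogonal hW (Complex.norm_exp_ofReal_mul_I _) ?_
    (Module.End.mem_eigenspace_iff.mp u.2) (Module.End.mem_eigenspace_iff.mp w.2)
  intro h
  exact hst (Subtype.ext (exp_inj ⟨ha.trans_le s.2.1, s.2.2.trans hb⟩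
    ⟨ha.trans_le t.2.1, t.2.2.trans hb⟩ h))

theorem cos_le_cos_of_abs_le {s r : ℝ} (h : |s| ≤ r) (hr : r ≤ Real.pi) :
    Real.cos r ≤ Real.cos s := by
  rw [← Real.cos_abs s]
  exact Real.cos_le_cos_of_nonneg_of_le_pi (abs_nonneg _) hr h

/-- On an eigenvector of angle `θ` the operator acts as `cos(θ - φ)`, and every angle of the arc is
within half its length of the midpoint `φ`. The eigenspaces are orthogonal, so the bounds add up. -/
theorem le_re_inner_cosOp {W : H →L[ℂ] H} (hW : W ∈ unitary (H →L[ℂ] H)) {a b : ℝ} (ha : 0 < a)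
    (hb : b < 2 * Real.pi) {v : H} (hv : v ∈ arcSpace W a b) :
    Real.cos ((b - a) / 2) * ‖v‖ ^ 2 ≤ (⟪v, cosOp W ((a + b) / 2) v⟫_ℂ).re := by
  classical
  let V : Set.Ico a b → Submodule ℂ H := fun θ =>
    Module.End.eigenspace (W : H →ₗ[ℂ] H) (Complex.exp (((θ : ℝ) : ℂ) * Complex.I))
  have hort : OrthogonalFamily ℂ (fun θ => V θ) (fun θ => (V θ).subtypeₗᵢ) :=
    orthogonalFamily_arc hW ha hb
  obtain ⟨l, hl⟩ := (Submodule.mem_iSup_iff_exists_dfinsupp' (p := V) v).mp hv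
  have hv1 : v = ∑ i ∈ l.support, (V i).subtypeₗᵢ (l i) := by
    rw [← hl]; rfl
  have hv2 : cosOp W ((a + b) / 2) v = ∑ i ∈ l.support,
      (V i).subtypeₗᵢ (((Real.cos (i - (a + b) / 2) : ℝ) : ℂ) • l i) := by
    rw [hv1, map_sum]
    refine Finset.sum_congr rfl fun i _ => ?_
    exact cosOp_apply_of_eigenvector hW (Module.End.mem_eigenspace_iff.mp (l i).2)
  have hn1 : ‖v‖ ^ 2 = ∑ i ∈ l.support, ‖l i‖ ^ 2 := by
    rw [hv1]; exact hort.norm_sum (fun i => l i) l.support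
  have hn2 : ⟪v, cosOp W ((a + b) / 2) v⟫_ℂ = ∑ i ∈ l.support,
      ⟪l i, ((Real.cos (i - (a + b) / 2) : ℝ) : ℂ) • l i⟫_ℂ := by
    rw [hv2]
    nth_rewrite 1 [hv1]
    exact hort.inner_sum (fun i => l i) (fun i => ((Real.cos (i - (a + b) / 2) : ℝ) : ℂ) • l i) _
  rw [hn2, hn1, Complex.re_sum, Finset.mul_sum]
  refine Finset.sum_le_sum fun i _ => ?_
  rw [inner_smul_right, inner_self_eq_norm_sq_to_K, Complex.re_ofReal_mul]
  have h1 : ((((‖l i‖ : ℝ) : ℂ)) ^ 2).re = ‖l i‖ ^ 2 := by norm_cast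
  have h2 : Real.cos ((b - a) / 2) ≤ Real.cos (i - (a + b) / 2) := by
    refine cos_le_cos_of_abs_le (abs_le.mpr ⟨?_, ?_⟩) ?_
    · linarith [i.2.1]
    · linarith [i.2.2]
    · linarith
  refine (mul_le_mul_of_nonneg_right h2 (by positivity)).trans ?_
  exact (congrArg _ h1).ge

theorem arcSpace_invariant {W T : H →L[ℂ] H} {a b : ℝ}
    (h : ∀ (θ : ℝ) (v : H), W v = Complex.exp (θ * Complex.I) • v → ∃ c : ℂ, T v = c • v) :
    ∀ v ∈ arcSpace W a b, T v ∈ arcSpace W a b := by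
  have : arcSpace W a b ≤ (arcSpace W a b).comap (T : H →ₗ[ℂ] H) := by
    refine iSup_le fun θ v hv => ?_
    obtain ⟨c, hc⟩ := h θ v (Module.End.mem_eigenspace_iff.mp hv)
    change T v ∈ arcSpace W a b
    rw [hc]
    refine Submodule.smul_mem _ _ ?_
    exact (le_iSup (fun θ : Set.Ico a b => Module.End.eigenspace (W : H →ₗ[ℂ] H)
      (Complex.exp (((θ : ℝ) : ℂ) * Complex.I))) θ) hv
  exact this

theorem exists_angle {w : ℂ} (hw : ‖w‖ = 1) :
    ∃ θ : ℝ, 0 ≤ θ ∧ θ < 2 * Real.pi ∧ Complex.exp (θ * Complex.I) = w := by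
  have h1 : Complex.exp (Complex.arg w * Complex.I) = w := by
    have := Complex.norm_mul_exp_arg_mul_I w
    rwa [hw, Complex.ofReal_one, one_mul] at this
  have hpi := Real.pi_pos
  rcases lt_or_ge (Complex.arg w) 0 with h | h
  · refine ⟨Complex.arg w + 2 * Real.pi, by linarith [Complex.neg_pi_lt_arg w], by linarith, ?_⟩
    push_cast
    rw [add_mul, Complex.exp_add, h1, Complex.exp_two_pi_mul_I, mul_one]
  · exact ⟨_, h, by linarith [Complex.arg_le_pi w], h1⟩

/-- With midpoint `φ` and half-length `r`, an angle off the arc has `r ≤ |θ - φ| ≤ 2π - r`, and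
there the cosine is at most `cos r`. The upper bound comes from `0 < a` and `b < 2π`. -/
theorem mem_Ioo_of_cos_lt {a b θ : ℝ} (ha : 0 < a) (hb : b < 2 * Real.pi) (hab : a ≤ b)
    (h0 : 0 ≤ θ) (h1 : θ < 2 * Real.pi)
    (h : Real.cos ((b - a) / 2) < Real.cos (θ - (a + b) / 2)) : θ ∈ Ioo a b := by
  have hpi := Real.pi_pos
  have key : ∀ s r : ℝ, r ≤ s → s ≤ 2 * Real.pi - r → 0 ≤ r → r ≤ Real.pi →
      Real.cos s ≤ Real.cos r := by
    intro s r h1 h2 h3 h4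
    rw [show Real.cos s = -Real.cos (s - Real.pi) by rw [Real.cos_sub_pi, neg_neg],
      show Real.cos r = -Real.cos (Real.pi - r) by rw [Real.cos_pi_sub, neg_neg]]
    exact neg_le_neg (cos_le_cos_of_abs_le (abs_le.mpr ⟨by linarith, by linarith⟩) (by linarith))
  by_contra hc
  rw [mem_Ioo, not_and_or, not_lt, not_lt] at hc
  rcases hc with hc | hc
  · have := key (-(θ - (a + b) / 2)) ((b - a) / 2) (by linarith) (by linarith) (by linarith)
      (by linarith)
    rw [Real.cos_neg] at this
    linarith
  · have := key (θ - (a + b) / 2) ((b - a) / 2) (by linarith) (by linarith) (by linarith)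
      (by linarith)
    linarith

theorem adjoint_commute {W : H →L[ℂ] H} (hW : W ∈ unitary (H →L[ℂ] H)) :
    Commute W (ContinuousLinearMap.adjoint W) :=
  (Unitary.mul_star_self_of_mem hW).trans (Unitary.star_mul_self_of_mem hW).symm

theorem commute_cosOp {W : H →L[ℂ] H} (hW : W ∈ unitary (H →L[ℂ] H)) (φ : ℝ) :
    Commute W (cosOp W φ) :=
  (((Commute.refl W).smul_right _).add_right ((adjoint_commute hW).smul_right _)).smul_right _

theorem orthogonal_invariant {V : Submodule ℂ H} {T : H →L[ℂ] H}
    (h : ∀ v ∈ V, ContinuousLinearMap.adjoint T v ∈ V) : ∀ v ∈ Vᗮ, T v ∈ Vᗮ := by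
  intro v hv u hu
  rw [← ContinuousLinearMap.adjoint_inner_left]
  exact hv _ (h u hu)

/-- On the orthogonal complement of the arc space `cosOp - cos φ` is compact and self-adjoint, so
only its eigenvalues matter. A too large eigenvalue would yield an eigenvector of `W` with angle in
the arc, which would lie both in the arc space and in its complement. -/
theorem re_inner_cosOp_le {W : H →L[ℂ] H} (hW : W ∈ YInf H) {a b : ℝ} (ha : 0 < a) (hab : a ≤ b)
    (hb : b < 2 * Real.pi) {v : H} (hv : v ∈ (arcSpace W a b)ᗮ) :
    (⟪v, cosOp W ((a + b) / 2) v⟫_ℂ).re ≤ Real.cos ((b - a) / 2) * ‖v‖ ^ 2 := by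
  set φ := (a + b) / 2 with hφ
  set X := (arcSpace W a b)ᗮ with hX
  have hpi := Real.pi_pos
  -- The angle `0` is off the arc. This makes the bound on the eigenvalues non-negative, so that an
  -- eigenvalue above it is non-zero.
  have hcos : Real.cos φ ≤ Real.cos ((b - a) / 2) := by
    by_contra! hlt
    have h0 := mem_Ioo_of_cos_lt (θ := 0) ha hb hab le_rfl (by positivity)
      (by rwa [zero_sub, Real.cos_neg])
    linarith [h0.1]
  let K₀ : H →L[ℂ] H := cosOp W φ - (Real.cos φ : ℂ) • (1 : H →L[ℂ] H)
  have hK₀ : IsSelfAdjoint K₀ := by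
    refine (isSelfAdjoint_cosOp W φ).sub ?_
    rw [IsSelfAdjoint, star_smul, star_one]
    congr 1
    exact Complex.conj_ofReal _
  have hK₀c : IsCompactOperator K₀ := isCompactOperator_cosOp_sub hW φ
  have hcosinv : ∀ u ∈ arcSpace W a b, K₀ u ∈ arcSpace W a b := by
    refine arcSpace_invariant fun θ u hu => ⟨Real.cos (θ - φ) - Real.cos φ, ?_⟩
    simp only [K₀, sub_apply, smul_apply, one_apply_eq_self]
    rw [cosOp_apply_of_eigenvector hW.1 hu, sub_smul]
  have hXK : ∀ u ∈ X, K₀ u ∈ X := orthogonal_invariant fun u hu => by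
    rw [← ContinuousLinearMap.star_eq_adjoint, hK₀.star_eq]
    exact hcosinv u hu
  have hXW : ∀ u ∈ X, W u ∈ X := orthogonal_invariant <| arcSpace_invariant fun θ u hu =>
    ⟨_, adjoint_apply_of_eigenvector hW.1 (Complex.norm_exp_ofReal_mul_I θ) hu⟩
  let K : X →L[ℂ] X := K₀.restrict hXK
  have hKsym : IsSelfAdjoint K := by
    rw [ContinuousLinearMap.isSelfAdjoint_iff_isSymmetric]
    exact (ContinuousLinearMap.isSelfAdjoint_iff_isSymmetric.mp hK₀).restrict_invariant hXK
  have hKc : IsCompactOperator K := hK₀c.restrict' hXK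
  have key := re_inner_le_of_hasEigenvalue_le hKsym hKc
    (c := Real.cos ((b - a) / 2) - Real.cos φ) (by linarith) ?_ ⟨v, hv⟩
  · have h1 : ⟪(⟨v, hv⟩ : X), K ⟨v, hv⟩⟫_ℂ = ⟪v, cosOp W φ v⟫_ℂ - Real.cos φ * (‖v‖ : ℂ) ^ 2 := by
      change ⟪v, cosOp W φ v - (Real.cos φ : ℂ) • v⟫_ℂ = _
      rw [inner_sub_right, inner_smul_right, inner_self_eq_norm_sq_to_K]
      rfl
    rw [h1, Complex.sub_re] at key
    have h2 : ((Real.cos φ : ℂ) * (‖v‖ : ℂ) ^ 2).re = Real.cos φ * ‖v‖ ^ 2 := by norm_cast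
    rw [h2] at key
    change _ ≤ (Real.cos ((b - a) / 2) - Real.cos φ) * ‖v‖ ^ 2 at key
    linarith
  · intro m hm hev
    have hm0 : (m : ℂ) ≠ 0 := by exact_mod_cast (show m ≠ 0 by linarith)
    -- The eigenspace is finite-dimensional and invariant under `W`, which commutes with `cosOp`;
    -- hence `W` has an eigenvector in it.
    have := ContinuousLinearMap.finite_dimensional_eigenspace hKc (m : ℂ) hm0
    let 𝓔 := Module.End.eigenspace (K : X →ₗ[ℂ] X) (m : ℂ)
    have hne : Nontrivial 𝓔 := (Submodule.nontrivial_iff_ne_bot).mpr hev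
    let WX : X →ₗ[ℂ] X := (W : H →ₗ[ℂ] H).restrict hXW
    have hcomm : ∀ u : X, K (WX u) = WX (K u) := fun u => by
      refine Subtype.ext ?_
      change cosOp W φ (W u) - (Real.cos φ : ℂ) • W u = W (cosOp W φ u - (Real.cos φ : ℂ) • (u : H))
      have h := congrArg (fun F : H →L[ℂ] H => F u) (commute_cosOp hW.1 φ).eq
      simp only [mul_apply_eq_comp] at h
      rw [map_sub, map_smul, ← h]
    have hinv : ∀ u ∈ 𝓔, WX u ∈ 𝓔 := fun u hu => by
      rw [Module.End.mem_eigenspace_iff] at hu ⊢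
      change K (WX u) = _
      rw [hcomm, show K u = (m : ℂ) • u from hu, map_smul]
    obtain ⟨w, hw⟩ := Module.End.exists_eigenvalue (WX.restrict hinv)
    obtain ⟨u, hu⟩ := hw.exists_hasEigenvector
    have hu1 : W ((u : X) : H) = w • ((u : X) : H) :=
      congrArg (fun q : 𝓔 => ((q : X) : H)) hu.apply_eq_smul
    have hu0 : ((u : X) : H) ≠ 0 := by
      intro h
      apply hu.2
      exact Subtype.ext (Subtype.ext h)
    have hw1 : ‖w‖ = 1 := by
      have h1 : ‖W ((u : X) : H)‖ = ‖((u : X) : H)‖ := by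
        have := ContinuousLinearMap.norm_map_of_mem_unitary hW.1 ((u : X) : H)
        exact this
      rw [hu1, norm_smul] at h1
      exact mul_right_cancel₀ (norm_ne_zero_iff.mpr hu0) (h1.trans (one_mul _).symm)
    obtain ⟨θ, hθ0, hθ1, rfl⟩ := exists_angle hw1
    have hu2 : K₀ ((u : X) : H) = (m : ℂ) • ((u : X) : H) :=
      congrArg (fun q : X => (q : H)) (Module.End.mem_eigenspace_iff.mp u.2)
    simp only [K₀, sub_apply, smul_apply, one_apply_eq_self] at hu2
    rw [cosOp_apply_of_eigenvector hW.1 hu1, ← sub_smul] at hu2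
    have hm2 := smul_left_injective ℂ hu0 hu2
    have hm3 : Real.cos (θ - φ) - Real.cos φ = m := by exact_mod_cast hm2
    have hθ := mem_Ioo_of_cos_lt ha hb hab hθ0 hθ1 (by rw [← hφ]; linarith)
    have hmem : ((u : X) : H) ∈ arcSpace W a b :=
      (le_iSup (fun θ : Set.Ico a b => Module.End.eigenspace (W : H →ₗ[ℂ] H)
        (Complex.exp (((θ : ℝ) : ℂ) * Complex.I))) ⟨θ, hθ.1.le, hθ.2⟩)
        (Module.End.mem_eigenspace_iff.mpr hu1)
    exact hu0 (inner_self_eq_zero.mp ((u : X).2 _ hmem))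

/-- The drop of the cosine over an interval of length `δ` in `[0, π]` is smallest at the end `0`.
This makes the perturbation bound independent of the arc. -/
theorem one_sub_cos_le {r δ : ℝ} (hr : 0 ≤ r) (hδ : 0 ≤ δ) (h : r + δ ≤ Real.pi) :
    1 - Real.cos δ ≤ Real.cos r - Real.cos (r + δ) := by
  have h1 : Real.cos r - Real.cos (r + δ) = 2 * Real.sin (r + δ / 2) * Real.sin (δ / 2) := by
    rw [Real.cos_sub_cos, show (r + (r + δ)) / 2 = r + δ / 2 by ring,
      show (r - (r + δ)) / 2 = -(δ / 2) by ring, Real.sin_neg]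
    ring
  have h2 : 1 - Real.cos δ = 2 * Real.sin (δ / 2) * Real.sin (δ / 2) := by
    have := Real.cos_sq_add_sin_sq (δ / 2)
    rw [show δ = 2 * (δ / 2) by ring, Real.cos_two_mul]
    simp only [mul_div_cancel_left₀ _ (two_ne_zero (α := ℝ))]
    nlinarith
  have h3 : 0 ≤ Real.sin (δ / 2) := Real.sin_nonneg_of_nonneg_of_le_pi (by linarith) (by linarith)
  have h4 : Real.sin (δ / 2) ≤ Real.sin (r + δ / 2) := by
    rw [← Real.cos_pi_div_two_sub, ← Real.cos_pi_div_two_sub]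
    exact cos_le_cos_of_abs_le (abs_le.mpr ⟨by linarith, by linarith⟩) (by linarith [Real.pi_pos])
  rw [h1, h2]
  gcongr

/-- Otherwise some non-zero `v` in the arc space of `W` is orthogonal to that of `W'` for the wider
arc. Both arcs have the same midpoint, and with `r` the half-length of the smaller one the two forms
at `v` differ by at least `(cos r - cos(r + δ))‖v‖²`, more than `‖W - W'‖` allows. -/
theorem arcRank_le_of_norm_sub_lt {W W' : H →L[ℂ] H} (hW : W ∈ YInf H) (hW' : W' ∈ YInf H)
    {a b δ : ℝ} (hδ : 0 ≤ δ) (hab : a ≤ b) (ha : 0 < a - δ) (hb : b + δ < 2 * Real.pi)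
    (hn : ‖W - W'‖ < 1 - Real.cos δ) : arcRank W a b ≤ arcRank W' (a - δ) (b + δ) := by
  by_contra! hlt
  have := arcSpace_finite hW (by linarith : 0 < a) (by linarith : b < 2 * Real.pi)
  have := arcSpace_finite hW' ha hb
  let V := arcSpace W a b
  let V' := arcSpace W' (a - δ) (b + δ)
  let P : V →ₗ[ℂ] V' := (V'.orthogonalProjectionOnto : H →ₗ[ℂ] V') ∘ₗ V.subtype
  obtain ⟨⟨v, hv⟩, hv1, hv0⟩ := (Submodule.ne_bot_iff _).mp (P.ker_ne_bot_of_finrank_lt hlt)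
  have hv' : v ∈ V'ᗮ := Submodule.orthogonalProjectionOnto_eq_zero_iff.mp hv1
  have h1 := le_re_inner_cosOp hW.1 (by linarith) (by linarith) hv
  have h2 := re_inner_cosOp_le hW' ha (by linarith) hb hv'
  rw [show (a - δ + (b + δ)) / 2 = (a + b) / 2 by ring,
    show (b + δ - (a - δ)) / 2 = (b - a) / 2 + δ by ring] at h2
  have h3 := re_inner_cosOp_sub_le W W' ((a + b) / 2) v
  have h4 := one_sub_cos_le (r := (b - a) / 2) (δ := δ) (by linarith) hδ (by linarith)
  have hv2 : 0 < ‖v‖ ^ 2 := by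
    have : v ≠ 0 := fun h => hv0 (Subtype.ext h)
    positivity
  nlinarith

theorem countN_self (W : H →L[ℂ] H) (a : Angle) : countN W a a = 0 := by simp [countN]

theorem countN_symm (W : H →L[ℂ] H) (a b : Angle) : countN W a b = -countN W b a := by
  rcases lt_trichotomy a b with h | rfl | h
  · simp [countN, h, not_lt_of_gt h]
  · simp [countN]
  · simp [countN, h, not_lt_of_gt h]

theorem countN_of_le {W : H →L[ℂ] H} (hW : W ∈ YInf H) {a b : Angle} (h : a ≤ b) :
    countN W a b = arcRank W a b := by
  rcases h.lt_or_eq with h | rfl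
  · simp [countN, h]
  · have h1 := arcRank_add hW a.2.1 (le_refl (a : ℝ)) (le_refl (a : ℝ)) a.2.2
    have h2 : arcRank W a a = 0 := by omega
    rw [countN_self, h2]
    rfl

/-- The counting function of `W'` on `[s, t)` is bounded by the one of `W` on the arc with both
endpoints moved outwards by `δ`, also for signed counts. -/
theorem countN_le_of_norm_sub_lt {W W' : H →L[ℂ] H} (hW : W ∈ YInf H) (hW' : W' ∈ YInf H)
    {δ : ℝ} (hδ : 0 ≤ δ) (hn : ‖W - W'‖ < 1 - Real.cos δ) {s s' t t' : Angle}
    (hs : (s : ℝ) = s' + δ) (ht : (t' : ℝ) = t + δ) : countN W' s t ≤ countN W s' t' := by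
  have hn' : ‖W' - W‖ < 1 - Real.cos δ := by rwa [norm_sub_rev]
  rcases le_total s t with h | h
  · have hst : (s : ℝ) ≤ t := h
    have h' : s' ≤ t' := show (s' : ℝ) ≤ t' by linarith
    rw [countN_of_le hW' h, countN_of_le hW h', show (s' : ℝ) = s - δ by linarith, ht]
    exact_mod_cast arcRank_le_of_norm_sub_lt hW' hW hδ hst (by linarith [s'.2.1])
      (by linarith [t'.2.2]) hn'
  · rw [countN_symm W' s t, countN_of_le hW' h]
    rcases le_total s' t' with h' | h'
    · rw [countN_of_le hW h']
      omega
    -- Both counts are now minus ranks and the wider arc belongs to `W'`, so the rank bound applies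
    -- with the two operators exchanged.
    · have hst : (t' : ℝ) ≤ s' := h'
      rw [countN_symm W, countN_of_le hW h', neg_le_neg_iff, show (t : ℝ) = t' - δ by linarith, hs]
      exact_mod_cast arcRank_le_of_norm_sub_lt hW hW' hδ hst (by linarith [t.2.1])
        (by linarith [s.2.2]) hn

/-- A single integer `k` must align the two counting functions: `g t ≤ f s + k` and `f t + k ≤ g s`
whenever `t = s + δ`. Additivity of the counts shows that each lower constraint on `k` is below each
upper one, so the supremum of the lower ones works. -/
theorem rho_etaInf_le {W W' : H →L[ℂ] H} (hW : W ∈ YInf H) (hW' : W' ∈ YInf H) {δ : ℝ}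
    (hδ : 0 < δ) (hδ1 : δ < Real.pi) (hn : ‖W - W'‖ < 1 - Real.cos δ) :
    rho (etaInf W) (etaInf W') ≤ δ := by
  have hpi := Real.pi_pos
  let f : Angle → ℤ := fun θ => countN W θ angPi
  let g : Angle → ℤ := fun θ => countN W' θ angPi
  -- `S` is the set of all values `g t - f s`, where `t = s + δ`
  let S : Set ℤ := {m | ∃ s t : Angle, (t : ℝ) = s + δ ∧ m = g t - f s}
  have hdiff : ∀ s t s' t' : Angle, (t : ℝ) = s + δ → (t' : ℝ) = s' + δ →
      g t - f s ≤ g s' - f t' := by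
    intro s t s' t' h h'
    have h1 := countN_le_of_norm_sub_lt hW hW' hδ.le hn h h'
    have h2 := countN_add hW' t s' angPi
    have h3 := countN_add hW s t' angPi
    simp only [f, g]
    linarith
  let s₀ : Angle := ⟨Real.pi / 2, by positivity, by linarith⟩
  let t₀ : Angle := ⟨Real.pi / 2 + δ, by positivity, by linarith⟩
  have hne : S.Nonempty := ⟨_, s₀, t₀, rfl, rfl⟩
  have hbd : BddAbove S := by
    refine ⟨g s₀ - f t₀, ?_⟩
    rintro _ ⟨s, t, h, rfl⟩
    exact hdiff s t s₀ t₀ h rfl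
  let k := sSup S
  rw [etaInf, dif_pos hW, etaInf, dif_pos hW', ← mk_shift k ⟨fun θ => countN W θ angPi, _⟩]
  refine (rho_le _ _).trans (rhoTilde_le_of_shifted hδ.le ?_ ?_)
  · intro s t h
    change f t + k ≤ g s
    have : k ≤ g s - f t := by
      refine csSup_le hne ?_
      rintro _ ⟨s', t', h', rfl⟩
      exact hdiff s' t' s t h' h
    linarith
  · intro s t h
    change g t ≤ f s + k
    have : g t - f s ≤ k := le_csSup hbd ⟨s, t, h, rfl⟩
    linarith

/-! ### The unitary factors of `M` -/

/-- The number `(s - z̄) / (s - z)`, of modulus one for real `s`. -/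
def cayleyFun (z : ℂ) (s : ℝ) : ℂ := 1 + (z - star z) * ((s : ℂ) - z)⁻¹

theorem cayleyFun_eq_div {z : ℂ} (hz : z.im ≠ 0) (s : ℝ) :
    cayleyFun z s = ((s : ℂ) - star z) / ((s : ℂ) - z) := by
  have := PVM.ofReal_sub_ne_zero hz s
  rw [cayleyFun]
  field_simp
  ring

theorem star_im_ne_zero {z : ℂ} (hz : z.im ≠ 0) : (star z).im ≠ 0 := by
  simpa using hz

theorem cayleyFun_star_eq_conj (z : ℂ) (s : ℝ) :
    cayleyFun (star z) s = (starRingEnd ℂ) (cayleyFun z s) := by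
  simp only [cayleyFun, map_add, map_one, map_mul, map_sub, map_inv₀, Complex.conj_ofReal,
    Complex.star_def, Complex.conj_conj]

theorem cayleyFun_mul_star {z : ℂ} (hz : z.im ≠ 0) (s : ℝ) :
    cayleyFun z s * cayleyFun (star z) s = 1 := by
  have h1 := PVM.ofReal_sub_ne_zero hz s
  have h2 := PVM.ofReal_sub_ne_zero (star_im_ne_zero hz) s
  rw [cayleyFun_eq_div hz, cayleyFun_eq_div (star_im_ne_zero hz), star_star]
  field_simp

/-- The unitary operator `I + (z - z̄)(f(A) - z)⁻¹`. -/
def cayley (f : ℝ → ℝ) (A : H →ₗ.[ℂ] H) (z : ℂ) : H →L[ℂ] H :=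
  1 + (z - star z) • resolv (funCalc f A) z

theorem opM_eq_cayley_mul_cayley (f : ℝ → ℝ) (A A₀ : H →ₗ.[ℂ] H) (z : ℂ) :
    opM z (funCalc f A) (funCalc f A₀) = cayley f A z * cayley f A₀ (star z) := by
  rw [opM, cayley, cayley, star_star]

theorem measurable_indicator_of_domRestrict {Ω : Set ℝ} (hΩ : MeasurableSet Ω) {f : ℝ → ℝ}
    (hf : Measurable (Ω.domRestrict f)) : Measurable (Ω.indicator f) := by
  refine measurable_of_restrict_of_restrict_compl hΩ ?_ ?_
  · convert hf using 1
    ext t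
    simp [t.2]
  · convert (measurable_const : Measurable fun _ : (Ωᶜ : Set ℝ) => (0 : ℝ)) using 1
    ext ⟨t, ht⟩
    exact indicator_of_notMem ht f

theorem bddMeas_cayleyFun {f : ℝ → ℝ} (hf : Measurable f) {z : ℂ} (hz : z.im ≠ 0) :
    PVM.BddMeas (fun t => cayleyFun z (f t)) :=
  (PVM.BddMeas.const 1).add ((PVM.bddMeas_resFun hf hz).const_mul _)

/-- Either `A` has no spectral measure and its functions have trivial resolvents by convention
(for self-adjoint `A` the spectral theorem excludes this), or `cayley f A z` is the integral of
`cayleyFun z ∘ f` against a projection-valued measure which is carried by `Ω`. -/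
theorem cayley_eq_one_or_represents {A : H →ₗ.[ℂ] H} {Ω : Set ℝ} (hΩ : MeasurableSet Ω)
    (hspec : spec A ⊆ Complex.ofReal '' Ω) :
    (∀ f z, cayley f A z = 1) ∨
    ∃ E : PVM H, (∀ x, ∀ᵐ t ∂(E.measure x), t ∈ Ω) ∧
      ∀ f, Measurable (Ω.domRestrict f) → ∀ z : ℂ, z.im ≠ 0 →
        E.Represents (fun t => cayleyFun z (Ω.indicator f t)) (cayley f A z) := by
  by_cases h : ∃ E : PVM H, E.IsIntegral (fun t => t) A
  · right
    set E := Classical.choose h with hE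
    have hEA : E.IsIntegral (fun t => t) A := Classical.choose_spec h
    have hΩE : ∀ x, ∀ᵐ t ∂(E.measure x), t ∈ Ω := fun x => by
      refine measure_mono_null (fun t ht => ?_) (hEA.measure_compl_spec x)
      intro hts
      obtain ⟨s, hs, hst⟩ := hspec hts
      rw [Complex.ofReal_inj] at hst
      exact ht (hst ▸ hs)
    refine ⟨E, hΩE, fun f hf z hz => ?_⟩
    have hg := measurable_indicator_of_domRestrict hΩ hf
    have hfg : ∀ x, Ω.indicator f =ᵐ[E.measure x] f := fun x => by
      filter_upwards [hΩE x] with t ht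
      exact indicator_of_mem ht f
    have hex : ∃ B, E.IsIntegral f B :=
      (E.exists_isIntegral hg).imp fun B hB => hB.congr hfg
    have hB : E.IsIntegral f (funCalc f A) := by
      rw [funCalc, dif_pos h, ← hE, PVM.integral, dif_pos hex]
      exact Classical.choose_spec hex
    have hB' : E.IsIntegral (Ω.indicator f) (funCalc f A) := hB.congr fun x => (hfg x).symm
    obtain ⟨R, hR⟩ := E.exists_represents (PVM.bddMeas_resFun hg hz)
    rw [cayley, (hB'.isResolventAt hg hz hR).resolv_eq]
    exact PVM.Represents.one.add (.const 1) ((PVM.bddMeas_resFun hg hz).const_mul _)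
      (hR.const_mul _)
  · left
    intro f z
    rw [cayley, funCalc, dif_neg h, resolv_bot, smul_zero, add_zero]

theorem cayley_mul_cayley_star {A : H →ₗ.[ℂ] H} {Ω : Set ℝ} (hΩ : MeasurableSet Ω)
    (hspec : spec A ⊆ Complex.ofReal '' Ω) {f : ℝ → ℝ} (hf : Measurable (Ω.domRestrict f)) {z : ℂ}
    (hz : z.im ≠ 0) : cayley f A z * cayley f A (star z) = 1 := by
  rcases cayley_eq_one_or_represents hΩ hspec with h | ⟨E, -, hE⟩
  · rw [h, h, mul_one]
  · have hg := measurable_indicator_of_domRestrict hΩ hf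
    have hz' := star_im_ne_zero hz
    exact (((hE f hf z hz).mul (bddMeas_cayleyFun hg hz) (bddMeas_cayleyFun hg hz')
      (hE f hf _ hz')).congr' fun t => cayleyFun_mul_star hz _).unique PVM.Represents.one

theorem star_cayley {A : H →ₗ.[ℂ] H} {Ω : Set ℝ} (hΩ : MeasurableSet Ω)
    (hspec : spec A ⊆ Complex.ofReal '' Ω) {f : ℝ → ℝ} (hf : Measurable (Ω.domRestrict f)) {z : ℂ}
    (hz : z.im ≠ 0) : star (cayley f A z) = cayley f A (star z) := by
  rcases cayley_eq_one_or_represents hΩ hspec with h | ⟨E, -, hE⟩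
  · rw [h, h, star_one]
  · exact ((hE f hf z hz).star.congr' fun t => (cayleyFun_star_eq_conj z _).symm).unique
      (hE f hf _ (star_im_ne_zero hz))

theorem cayley_mem_unitary {A : H →ₗ.[ℂ] H} {Ω : Set ℝ} (hΩ : MeasurableSet Ω)
    (hspec : spec A ⊆ Complex.ofReal '' Ω) {f : ℝ → ℝ} (hf : Measurable (Ω.domRestrict f)) {z : ℂ}
    (hz : z.im ≠ 0) : cayley f A z ∈ unitary (H →L[ℂ] H) := by
  have h1 := cayley_mul_cayley_star hΩ hspec hf hz
  have h2 := cayley_mul_cayley_star hΩ hspec hf (star_im_ne_zero hz)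
  rw [star_star] at h2
  rw [Unitary.mem_iff, star_cayley hΩ hspec hf hz]
  exact ⟨h2, h1⟩

theorem norm_cayley_sub_le {A : H →ₗ.[ℂ] H} {Ω : Set ℝ} (hΩ : MeasurableSet Ω)
    (hspec : spec A ⊆ Complex.ofReal '' Ω) {f g : ℝ → ℝ} (hf : Measurable (Ω.domRestrict f))
    (hg : Measurable (Ω.domRestrict g)) {z w : ℂ} (hz : z.im ≠ 0) (hw : w.im ≠ 0) {ε : ℝ}
    (hε : 0 ≤ ε) (h : ∀ t ∈ Ω, ‖cayleyFun z (f t) - cayleyFun w (g t)‖ ≤ ε) :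
    ‖cayley f A z - cayley g A w‖ ≤ ε := by
  rcases cayley_eq_one_or_represents hΩ hspec with h1 | ⟨E, hEΩ, hE⟩
  · rw [h1, h1, sub_self, norm_zero]
    exact hε
  · have hf' := bddMeas_cayleyFun (measurable_indicator_of_domRestrict hΩ hf) hz
    have hg' := bddMeas_cayleyFun (measurable_indicator_of_domRestrict hΩ hg) hw
    refine ((hE f hf z hz).sub hf' hg' (hE g hg w hw)).norm_le (hf'.sub hg') hε fun x => ?_
    filter_upwards [hEΩ x] with t ht
    rw [indicator_of_mem ht, indicator_of_mem ht]
    exact h t ht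

/-- The transforms of `f(A₀)` at `z` and `z̄` are mutually inverse, so `M - I` is the difference of
the transforms of `f(A)` and `f(A₀)` at `z`, a multiple of the resolvent difference, times a bounded
operator. -/
theorem opM_mem_YInf {A A₀ : H →ₗ.[ℂ] H} {Ω : Set ℝ} (hΩ : MeasurableSet Ω)
    (hA : spec A ⊆ Complex.ofReal '' Ω) (hA₀ : spec A₀ ⊆ Complex.ofReal '' Ω) {f : ℝ → ℝ}
    (hf : Measurable (Ω.domRestrict f)) (hc : CompactResolventDiff (funCalc f A) (funCalc f A₀))
    {z : ℂ} (hz : z.im ≠ 0) : opM z (funCalc f A) (funCalc f A₀) ∈ YInf H := by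
  rw [opM_eq_cayley_mul_cayley]
  refine ⟨mul_mem (cayley_mem_unitary hΩ hA hf hz)
    (cayley_mem_unitary hΩ hA₀ hf (star_im_ne_zero hz)), ?_⟩
  have h1 : cayley f A z * cayley f A₀ (star z) - 1 =
      ((z - star z) • (resolv (funCalc f A) z - resolv (funCalc f A₀) z)) *
        cayley f A₀ (star z) := by
    rw [← cayley_mul_cayley_star hΩ hA₀ hf hz, ← sub_mul, cayley, cayley, smul_sub]
    congr 1
    abel
  rw [h1]
  exact ((hc z hz).smul (z - star z)).comp_clm (cayley f A₀ (star z))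

theorem norm_le_one_of_mem_unitary {U : H →L[ℂ] H} (hU : U ∈ unitary (H →L[ℂ] H)) : ‖U‖ ≤ 1 :=
  U.opNorm_le_bound zero_le_one fun x => by
    rw [ContinuousLinearMap.norm_map_of_mem_unitary hU, one_mul]

theorem norm_opM_sub_le {A A₀ : H →ₗ.[ℂ] H} {Ω : Set ℝ} (hΩ : MeasurableSet Ω)
    (hA : spec A ⊆ Complex.ofReal '' Ω) (hA₀ : spec A₀ ⊆ Complex.ofReal '' Ω) {f g : ℝ → ℝ}
    (hf : Measurable (Ω.domRestrict f)) (hg : Measurable (Ω.domRestrict g)) {z w : ℂ}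
    (hz : z.im ≠ 0) (hw : w.im ≠ 0) {ε : ℝ} (hε : 0 ≤ ε)
    (h : ∀ t ∈ Ω, ‖cayleyFun z (f t) - cayleyFun w (g t)‖ ≤ ε) :
    ‖opM z (funCalc f A) (funCalc f A₀) - opM w (funCalc g A) (funCalc g A₀)‖ ≤ 2 * ε := by
  have hz' := star_im_ne_zero hz
  have hw' := star_im_ne_zero hw
  have h1 := norm_cayley_sub_le hΩ hA hf hg hz hw hε h
  have h2 := norm_cayley_sub_le hΩ hA₀ hf hg hz' hw' hε fun t ht => by
    rw [cayleyFun_star_eq_conj, cayleyFun_star_eq_conj, ← map_sub, RCLike.norm_conj]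
    exact h t ht
  have h3 := norm_le_one_of_mem_unitary (cayley_mem_unitary hΩ hA₀ hf hz')
  have h4 := norm_le_one_of_mem_unitary (cayley_mem_unitary hΩ hA hg hw)
  rw [opM_eq_cayley_mul_cayley, opM_eq_cayley_mul_cayley]
  calc ‖cayley f A z * cayley f A₀ (star z) - cayley g A w * cayley g A₀ (star w)‖
      = ‖(cayley f A z - cayley g A w) * cayley f A₀ (star z) +
          cayley g A w * (cayley f A₀ (star z) - cayley g A₀ (star w))‖ := by
        congr 1; noncomm_ring
    _ ≤ ε * 1 + 1 * ε := by
        refine (norm_add_le _ _).trans (add_le_add ?_ ?_)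
        · exact (norm_mul_le _ _).trans (mul_le_mul h1 h3 (norm_nonneg _) hε)
        · exact (norm_mul_le _ _).trans (mul_le_mul h4 h2 (norm_nonneg _) zero_le_one)
    _ = 2 * ε := by ring

/-! ### Comparison of the symbols -/

theorem cayleyFun_eq (a s y : ℝ) :
    cayleyFun ((a : ℂ) + (y : ℂ) * Complex.I) s =
      1 + 2 * y * Complex.I / (((s - a : ℝ) : ℂ) - y * Complex.I) := by
  rw [cayleyFun, div_eq_mul_inv]
  congr 2
  · simp only [Complex.star_def, map_add, map_mul, Complex.conj_ofReal, Complex.conj_I]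
    ring
  · push_cast
    ring

theorem abs_le_norm_ofReal_sub (p y : ℝ) : |p| ≤ ‖(p : ℂ) - y * Complex.I‖ := by
  simpa using Complex.abs_re_le_norm ((p : ℂ) - y * Complex.I)

theorem le_norm_ofReal_sub (p y : ℝ) : y ≤ ‖(p : ℂ) - y * Complex.I‖ := by
  refine (le_abs_self y).trans ?_
  simpa using Complex.abs_im_le_norm ((p : ℂ) - y * Complex.I)

theorem norm_two_mul_div_le {p y c : ℝ} (hy : 0 < y) (hc : 0 < c) (hp : c ≤ |p|) :
    ‖2 * y * Complex.I / ((p : ℂ) - y * Complex.I)‖ ≤ 2 * y / c := by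
  rw [norm_div]
  have h1 : ‖(2 * y * Complex.I : ℂ)‖ = 2 * y := by
    simp [abs_of_pos hy]
  rw [h1]
  gcongr
  exact hp.trans (abs_le_norm_ofReal_sub p y)

/-- The difference equals `2iy(q - p)/((p - iy)(q - iy))`. Bounding the factors below by `|p|` and
by `y` cancels `y`, so a relative error of `q` against `p` gives an estimate uniform in `y`. -/
theorem norm_two_mul_div_sub_le {p q y ε : ℝ} (hy : 0 < y) (hε : 0 ≤ ε)
    (h : |q - p| ≤ ε / 2 * |p|) :
    ‖2 * y * Complex.I / ((p : ℂ) - y * Complex.I) -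
      2 * y * Complex.I / ((q : ℂ) - y * Complex.I)‖ ≤ ε := by
  have hp0 : 0 < ‖(p : ℂ) - y * Complex.I‖ := hy.trans_le (le_norm_ofReal_sub p y)
  have hq0 : 0 < ‖(q : ℂ) - y * Complex.I‖ := hy.trans_le (le_norm_ofReal_sub q y)
  have h1 : 2 * y * Complex.I / ((p : ℂ) - y * Complex.I) -
      2 * y * Complex.I / ((q : ℂ) - y * Complex.I) =
      2 * y * Complex.I * ((q - p : ℝ) : ℂ) /
        (((p : ℂ) - y * Complex.I) * ((q : ℂ) - y * Complex.I)) := by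
    have := norm_pos_iff.mp hp0
    have := norm_pos_iff.mp hq0
    push_cast
    field_simp
    ring
  rw [h1, norm_div, norm_mul _ (((q - p : ℝ) : ℂ)), norm_mul (_ - _), Complex.norm_real,
    Real.norm_eq_abs, div_le_iff₀ (mul_pos hp0 hq0)]
  have h2 : ‖(2 * y * Complex.I : ℂ)‖ = 2 * y := by
    simp [abs_of_pos hy]
  rw [h2]
  calc 2 * y * |q - p| ≤ 2 * y * (ε / 2 * |p|) := by gcongr
    _ = ε * (|p| * y) := by ring
    _ ≤ ε * (‖(p : ℂ) - y * Complex.I‖ * ‖(q : ℂ) - y * Complex.I‖) := by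
      gcongr
      · exact abs_le_norm_ofReal_sub p y
      · exact le_norm_ofReal_sub q y

theorem eventually_norm_cayleyFun_sub_le {Ω : Set ℝ} {f g : ℝ → ℝ} {l : ℝ}
    (hf : FunCondition Ω f l) (hg : FunCondition Ω g l) {ε : ℝ} (hε : 0 < ε) :
    ∀ᶠ y : ℝ in 𝓝[>] 0, ∀ t ∈ Ω, ‖cayleyFun ((f l : ℂ) + (y : ℂ) * Complex.I) (f t) -
      cayleyFun ((g l : ℂ) + ((deriv g l / deriv f l * y : ℝ) : ℂ) * Complex.I) (g t)‖ ≤ ε := by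
  set c := deriv g l / deriv f l with hc
  have hf' := hf.deriv_pos
  have hg' := hg.deriv_pos
  have hc0 : 0 < c := by positivity
  have hdf := hf.differentiable.hasDerivAt
  have hdg := hg.differentiable.hasDerivAt
  have hdiff : HasDerivAt (fun t => g t / c - f t) 0 l := by
    have := (hdg.div_const c).sub hdf
    rwa [show deriv g l / c - deriv f l = 0 by rw [hc]; field_simp; ring] at this
  -- Since `f'(l) ≠ 0`, being small relative to `t - l` is the same as being small relative to `f t
  -- - f l`.
  have hlo : (fun t => (g t / c - f t) - (g l / c - f l)) =o[𝓝 l] fun t => f t - f l := by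
    have h1 := hdiff.isLittleO
    simp only [smul_zero, sub_zero] at h1
    exact h1.trans_isBigO ((hdf.isTheta_sub hf'.ne').symm.isBigO.comp_tendsto
      (tendsto_id.prodMk (tendsto_pure.mpr (Eventually.of_forall fun _ => rfl))))
  have hnear := hlo.def (c := ε / 2) (by positivity)
  obtain ⟨δ, hδ, hball⟩ := Metric.eventually_nhds_iff.mp hnear
  -- The radius is halved so that the points with `|t - l| ≤ δ / 2` lie in the open ball of radius
  -- `δ`.
  obtain ⟨a, ha, hfa⟩ := hf.separated (δ / 2) (by positivity)
  obtain ⟨b, hb, hgb⟩ := hg.separated (δ / 2) (by positivity)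
  have hsmall : ∀ᶠ y : ℝ in 𝓝[>] 0, 2 * y / a + 2 * y / (b / c) < ε := by
    have h1 : Tendsto (fun y : ℝ => 2 * y / a + 2 * y / (b / c)) (𝓝 0) (𝓝 0) := by
      have : Continuous fun y : ℝ => 2 * y / a + 2 * y / (b / c) := by fun_prop
      simpa using this.tendsto 0
    exact (h1.mono_left nhdsWithin_le_nhds).eventually_lt_const hε
  filter_upwards [hsmall, self_mem_nhdsWithin] with y hy hy0
  have hy0 : 0 < y := hy0
  intro t ht
  have hscale : 2 * ((c * y : ℝ) : ℂ) * Complex.I /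
      (((g t - g l : ℝ) : ℂ) - ((c * y : ℝ) : ℂ) * Complex.I) =
      2 * y * Complex.I / ((((g t - g l) / c : ℝ) : ℂ) - y * Complex.I) := by
    have h1 : ((g t - g l : ℝ) : ℂ) - ((c * y : ℝ) : ℂ) * Complex.I =
        c * ((((g t - g l) / c : ℝ) : ℂ) - y * Complex.I) := by
      have : (c : ℂ) ≠ 0 := by exact_mod_cast hc0.ne'
      push_cast
      field_simp
    rw [h1, show 2 * ((c * y : ℝ) : ℂ) * Complex.I = c * (2 * y * Complex.I) by push_cast; ring,
      mul_div_mul_left _ _ (by exact_mod_cast hc0.ne')]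
  rw [cayleyFun_eq, cayleyFun_eq, hscale, add_sub_add_left_eq_sub]
  rcases lt_or_ge (δ / 2) |t - l| with hfar | hclose
  · refine (norm_sub_le _ _).trans ((add_le_add (norm_two_mul_div_le hy0 ha (hfa t ht hfar))
      (norm_two_mul_div_le hy0 (div_pos hb hc0) ?_)).trans hy.le)
    rw [abs_div, abs_of_pos hc0]
    gcongr
    exact hgb t ht hfar
  · refine norm_two_mul_div_sub_le hy0 hε.le ?_
    have h2 := hball (y := t) (by rw [Real.dist_eq]; linarith)
    rw [Real.norm_eq_abs, Real.norm_eq_abs] at h2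
    convert h2 using 2
    ring

/-! ### The invariance principle -/

theorem im_ne_zero_of_pos (a : ℝ) {y : ℝ} (hy : 0 < y) :
    ((a : ℂ) + (y : ℂ) * Complex.I).im ≠ 0 := by
  simpa using hy.ne'

theorem tendsto_rho_etaCurve {A A₀ : H →ₗ.[ℂ] H} {Ω : Set ℝ} (hΩ : MeasurableSet Ω)
    (hA : spec A ⊆ Complex.ofReal '' Ω) (hA₀ : spec A₀ ⊆ Complex.ofReal '' Ω) {f g : ℝ → ℝ} {l : ℝ}
    (hf : FunCondition Ω f l) (hg : FunCondition Ω g l)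
    (hcf : CompactResolventDiff (funCalc f A) (funCalc f A₀))
    (hcg : CompactResolventDiff (funCalc g A) (funCalc g A₀)) :
    Tendsto (fun y => rho (etaCurve f l A A₀ y) (etaCurve g l A A₀ (deriv g l / deriv f l * y)))
      (𝓝[>] (0 : ℝ)) (𝓝 0) := by
  have hc0 : 0 < deriv g l / deriv f l := div_pos hg.deriv_pos hf.deriv_pos
  have hpi := Real.pi_pos
  rw [Metric.tendsto_nhds]
  intro r hr
  let δ := min (r / 2) (Real.pi / 2)
  have hδ : 0 < δ := by positivity
  have hδr : δ < r := (min_le_left _ _).trans_lt (by linarith)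
  have hδpi : δ < Real.pi := (min_le_right _ _).trans_lt (by linarith)
  have hcos : 0 < 1 - Real.cos δ := by
    have := Real.cos_lt_cos_of_nonneg_of_le_pi le_rfl hδpi.le hδ
    rw [Real.cos_zero] at this
    linarith
  -- The two factors of `M` double this tolerance to `(1 - cos δ)/2`, strictly below the threshold
  -- `1 - cos δ`.
  filter_upwards [eventually_norm_cayleyFun_sub_le hf hg (ε := (1 - Real.cos δ) / 4) (by linarith),
    self_mem_nhdsWithin] with y hy hy0
  have hz := im_ne_zero_of_pos (f l) (y := y) hy0
  have hw := im_ne_zero_of_pos (g l) (mul_pos hc0 hy0)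
  have h1 := norm_opM_sub_le hΩ hA hA₀ hf.borel hg.borel hz hw (by linarith) hy
  have h2 := rho_etaInf_le (opM_mem_YInf hΩ hA hA₀ hf.borel hcf hz)
    (opM_mem_YInf hΩ hA hA₀ hg.borel hcg hw) hδ hδpi (by linarith)
  rw [Real.dist_eq, sub_zero, abs_of_nonneg (rho_nonneg _ _)]
  exact h2.trans_lt hδr

/-- Multiplication by a positive constant preserves `y → 0+`, so the reparametrised `g`-curve has
the same limit, and the triangle inequality passes it to the `f`-curve. -/
theorem XLimit.transfer {A A₀ : H →ₗ.[ℂ] H} {Ω : Set ℝ} (hΩ : MeasurableSet Ω)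
    (hA : spec A ⊆ Complex.ofReal '' Ω) (hA₀ : spec A₀ ⊆ Complex.ofReal '' Ω) {f g : ℝ → ℝ} {l : ℝ}
    (hf : FunCondition Ω f l) (hg : FunCondition Ω g l)
    (hcf : CompactResolventDiff (funCalc f A) (funCalc f A₀))
    (hcg : CompactResolventDiff (funCalc g A) (funCalc g A₀)) {L : XInf}
    (h : XLimit (etaCurve g l A A₀) L) : XLimit (etaCurve f l A A₀) L := by
  have hc0 : 0 < deriv g l / deriv f l := div_pos hg.deriv_pos hf.deriv_pos
  have h1 := tendsto_rho_etaCurve hΩ hA hA₀ hf hg hcf hcg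
  have h2 : Tendsto (fun y : ℝ => deriv g l / deriv f l * y) (𝓝[>] 0) (𝓝[>] 0) := by
    refine tendsto_nhdsWithin_iff.mpr ⟨?_, ?_⟩
    · have : Continuous fun y : ℝ => deriv g l / deriv f l * y := by fun_prop
      have := this.tendsto 0
      rw [mul_zero] at this
      exact this.mono_left nhdsWithin_le_nhds
    · filter_upwards [self_mem_nhdsWithin] with y hy
      exact mul_pos hc0 hy
  have h3 := h1.add (Tendsto.comp h h2)
  rw [add_zero] at h3
  exact squeeze_zero (fun y => rho_nonneg _ _) (fun y => rho_triangle _ _ _) h3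

end InvPrinciple

end

theorem theoremf2 {𝓗 : Type*} [NormedAddCommGroup 𝓗] [InnerProductSpace ℂ 𝓗] [CompleteSpace 𝓗]
    (H₀ H : 𝓗 →ₗ.[ℂ] 𝓗) (hH₀ : IsSelfAdjoint H₀) (hH : IsSelfAdjoint H)
    (Ω : Set ℝ) (hΩ : MeasurableSet Ω)
    (hspec : spec H₀ ∪ spec H ⊆ Complex.ofReal '' Ω)
    (l : ℝ) (f₁ f₂ : ℝ → ℝ)
    (hf₁ : FunCondition Ω f₁ l) (hf₂ : FunCondition Ω f₂ l)
    (hc₁ : CompactResolventDiff (funCalc f₁ H) (funCalc f₁ H₀))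
    (hc₂ : CompactResolventDiff (funCalc f₂ H) (funCalc f₂ H₀)) :
    ((∃ L : XInf, XLimit (etaCurve f₁ l H H₀) L) ↔
      (∃ L : XInf, XLimit (etaCurve f₂ l H H₀) L)) ∧
    ∀ L₁ L₂ : XInf, XLimit (etaCurve f₁ l H H₀) L₁ → XLimit (etaCurve f₂ l H H₀) L₂ →
      L₁ = L₂ := by
  have hA₀ : spec H₀ ⊆ Complex.ofReal '' Ω := subset_union_left.trans hspec
  have hA : spec H ⊆ Complex.ofReal '' Ω := subset_union_right.trans hspec
  have h₁₂ : ∀ L, XLimit (etaCurve f₁ l H H₀) L → XLimit (etaCurve f₂ l H H₀) L := fun _ h =>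
    h.transfer hΩ hA hA₀ hf₂ hf₁ hc₂ hc₁
  have h₂₁ : ∀ L, XLimit (etaCurve f₂ l H H₀) L → XLimit (etaCurve f₁ l H H₀) L := fun _ h =>
    h.transfer hΩ hA hA₀ hf₁ hf₂ hc₁ hc₂
  exact ⟨⟨fun ⟨L, h⟩ => ⟨L, h₁₂ L h⟩, fun ⟨L, h⟩ => ⟨L, h₂₁ L h⟩⟩,
    fun L₁ L₂ h₁ h₂ => (h₁₂ L₁ h₁).unique h₂⟩
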